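/- **Model.** Let $n,m\ge 1$ and $\lambda>0$. For each $k\ge n+m$ consider $k$ first-come-first-served, unit-speed servers with infinite buffers. Batches of $n$ jobs arrive according to a Poisson process of intensity $\lambda k/n$. Each batch is coded into $n+m$ jobs, which are sent to $n+m$ queues chosen uniformly at random without replacement; all service requirements are independent exponentials of rate $1$. As soon as any $n$ coded jobs of a batch are completed, its remaining $m$ jobs are removed from the system, including those in service. Suppose that for each $k$ the system is stationary: the vector $(W_1,\dots,W_k)$ of workloads (the workload of a queue is the time to empty it if there were no more arrivals) has the same law at successive batch arrivals. Let $T_i=W_i+E_i$, with $E_i$ independent exponentials of rate $1$ that are also independent of the workloads, be the completion time of a virtual job at queue $i$ that is subject to neither coding nor removal. **Assumption (asymptotic independence).** As $k\to\infty$, for all distinct $i_1,\dots,i_{n+m}\le k$ the joint law of $(T_{i_1},\dots,T_{i_{n+m}})$ and the product of the laws of $T_{i_1},\dots,T_{i_{n+m}}$ become indistinguishable: for every bounded continuous function the difference of the two integrals tends to $0$, uniformly in $i_1,\dots,i_{n+m}$. Let $V$ be a real random variable that is the limit in distribution of $T_i$ as $k\to\infty$ (uniformly in $i$). **Theorem.**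 Under this assumption, with $\alpha=\lambda(m+n)/n$: 1. For all $t\ge 0$ (with the right derivative at $t=0$), $$\frac{d P(V>t)}{dt}=-P(V>t)+\alpha(n+m-1)\binom{n+m-2}{n-1}\sum_{i=0}^{n-1}\binom{n-1}{i}(-1)^i\frac{1}{(m+i)(m+i+1)}\bigl(P(V>t)\bigr)^{m+i+1}.$$ 2. $\limsup_{t\to\infty}e^{t}P(V>t)<\infty$. 3. As $k\to\infty$ the completion time of a batch converges in distribution, with convergence of $P(\cdot>t)$ for every $t$, to a random variable $C_{n,m}$ that has the law of the $n$-th smallest of $n+m$ independent copies of $V$, and for all $t$ $$P(C_{n,m}>t)=(n+m)\binom{n+m-1}{n-1}\sum_{i=0}^{n-1}\binom{n-1}{i}(-1)^i\frac{1}{m+i+1}\bigl(P(V>t)\bigr)^{m+i+1}.$$ 4. $\limsup_{t\to\infty}e^{(m+1)t}P(C_{n,m}>t)<\infty$. 5. For every integer $d$ with $2\le d\le m$, the tail of $C_{n,m}$ is of smaller order than the tail of the completion time of a batch of $n$ jobs under replication at $d$ queues with redundant removal: $$P(C_{n,m}>t)=o\!\left(1-\Bigl(1-\Bigl(\tfrac{1}{\lambda+(1-\lambda)e^{t(d-1)}}\Bigr)^{d/(d-1)}\Bigr)^{n}\right)\qquad(t\to\infty).$$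 -/

import Mathlib

open MeasureTheory ProbabilityTheory Filter Topology Set Asymptotics
open scoped BoundedContinuousFunction ENNReal

noncomputable section

namespace MDSQueue

/-- The `n`-th smallest of the numbers `x j`: the first time at which at least `n` of the
events with epochs `x j` have happened. -/
def orderStat {N : ℕ} (n : ℕ) (x : Fin N → ℝ) : ℝ :=
  sInf {t : ℝ | n ≤ (Finset.univ.filter fun j => x j ≤ t).card}

/-- A batch arrives, finds the workloads `w` in the `k` queues (the workload of a queue is the time
to empty it if there were no more arrivals), and its coded jobs `j`, with service requirements
`e j`, go to the queues `σ j`. Under first-come-first-served, job `j` would be completed, if it were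
never removed, at time `w (σ j) + e j` after its arrival. The batch is complete as soon as `n` of
its coded jobs are. -/
def completionTime {k N : ℕ} (n : ℕ) (w : Fin k → ℝ) (σ : Fin N → Fin k) (e : Fin N → ℝ) : ℝ :=
  orderStat n fun j => w (σ j) + e j

/-- The amount of service that coded job `j` receives. It enters service at time `w (σ j)` and
leaves at its own completion or at the completion of the batch, whichever is first; it is removed
without any service if the batch is completed before it enters service. -/
def receivedService {k N : ℕ} (n : ℕ) (w : Fin k → ℝ) (σ : Fin N → Fin k) (e : Fin N → ℝ)
    (j : Fin N) : ℝ :=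
  max 0 (min (e j) (completionTime n w σ e - w (σ j)))

/-- The workloads just after the arrival of the batch. -/
def workloadAfter {k N : ℕ} (n : ℕ) (w : Fin k → ℝ) (σ : Fin N → Fin k) (e : Fin N → ℝ) :
    Fin k → ℝ :=
  fun q => w q + ∑ j ∈ Finset.univ.filter (fun j => σ j = q), receivedService n w σ e j

/-- The workloads found by the next batch, which arrives `a` time units later
(each server works at unit speed while its queue is nonempty). -/
def nextWorkload {k N : ℕ} (n : ℕ) (w : Fin k → ℝ) (σ : Fin N → Fin k) (e : Fin N → ℝ) (a : ℝ) :
    Fin k → ℝ :=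
  fun q => max 0 (workloadAfter n w σ e q - a)

/-- Joint law of the workloads found by an arriving batch (law `π`), of the `N` queues chosen
uniformly at random without replacement, and of the i.i.d. unit-rate exponential service
requirements; the three are independent. -/
def arrivalLaw {k : ℕ} (N : ℕ) (π : Measure (Fin k → ℝ)) :
    Measure ((Fin k → ℝ) × (Fin N → Fin k) × (Fin N → ℝ)) :=
  π.prod ((uniformOn {σ : Fin N → Fin k | Function.Injective σ}).prod
    (Measure.pi fun _ : Fin N => expMeasure 1))

/-- One step of the Markov chain of the workloads found by successive batches. Batches form a
Poisson process of intensity `lam * k / n`, i.e. the interarrival times are independent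
exponentials of that rate. -/
def stepLaw {k : ℕ} (n m : ℕ) (lam : ℝ) (π : Measure (Fin k → ℝ)) : Measure (Fin k → ℝ) :=
  ((arrivalLaw (n + m) π).prod (expMeasure (lam * k / n))).map
    fun p => nextWorkload n p.1.1 p.1.2.1 p.1.2.2 p.2

/-- `π` is a stationary law of the workloads found by arriving batches in the system with `k`
queues. -/
structure IsStationary {k : ℕ} (n m : ℕ) (lam : ℝ) (π : Measure (Fin k → ℝ)) : Prop where
  isProbabilityMeasure : IsProbabilityMeasure π
  nonneg : ∀ᵐ w ∂π, ∀ q, 0 ≤ w q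
  invariant : stepLaw n m lam π = π

/-- Law of the completion time of a batch that finds workloads with law `π`. -/
def completionLaw {k : ℕ} (n m : ℕ) (π : Measure (Fin k → ℝ)) : Measure ℝ :=
  (arrivalLaw (n + m) π).map fun p => completionTime n p.1 p.2.1 p.2.2

/-- Law of the completion time `T i = W i + E i` of a virtual job at queue `i` that is subject to
neither coding nor removal. -/
def virtualLaw {k : ℕ} (π : Measure (Fin k → ℝ)) (i : Fin k) : Measure ℝ :=
  (π.prod (expMeasure 1)).map fun p => p.1 i + p.2

/-- Joint law of the completion times `T (ι j) = W (ι j) + E j` of virtual jobs at the queues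
`ι j`, with independent service requirements `E j`. -/
def jointVirtualLaw {k N : ℕ} (π : Measure (Fin k → ℝ)) (ι : Fin N → Fin k) :
    Measure (Fin N → ℝ) :=
  (π.prod (Measure.pi fun _ : Fin N => expMeasure 1)).map fun p j => p.1 (ι j) + p.2 j

/-- Asymptotic independence of the queues: as the number `k` of queues grows, the joint law of
the virtual completion times at any `N` distinct queues and the product of their
laws become indistinguishable by bounded continuous functions. -/
def AsymptoticallyIndependent (N : ℕ) (π : (k : ℕ) → Measure (Fin k → ℝ)) : Prop :=
  ∀ f : (Fin N → ℝ) →ᵇ ℝ, ∀ ε > 0, ∀ᶠ k : ℕ in atTop,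
    ∀ ι : Fin N → Fin k, Function.Injective ι →
      |∫ x, f x ∂(jointVirtualLaw (π k) ι)
        - ∫ x, f x ∂(Measure.pi fun j => virtualLaw (π k) (ι j))| < ε

/-- `ν` is the law of the virtual waiting time in the limit of many queues: the virtual completion
time at a queue converges in distribution to `ν`, whichever queue it is. -/
def IsLimitVirtualLaw (π : (k : ℕ) → Measure (Fin k → ℝ)) (ν : Measure ℝ) : Prop :=
  ∀ f : ℝ →ᵇ ℝ, ∀ ε > 0, ∀ᶠ k : ℕ in atTop, ∀ i : Fin k,
    |∫ x, f x ∂(virtualLaw (π k) i) - ∫ x, f x ∂ν| < ε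

/-- Tail `P (R > t)` of the completion time of a batch of `n` jobs when each job is replicated at
`d ≥ 2` queues, with removal of the redundant copies, in the limit of many queues. -/
def replicationTail (lam : ℝ) (n d : ℕ) (t : ℝ) : ℝ :=
  1 - (1 - (1 / (lam + (1 - lam) * Real.exp (t * ((d : ℝ) - 1)))) ^ ((d : ℝ) / ((d : ℝ) - 1))) ^ n

end MDSQueue

end

/-! Write H(t) = P(V > t), W for the workload that a batch finds at a queue and X for the workload
just after the arrival. The heart of the proof is a level-crossing balance. Since the next W is (X -
A)⁺ with A exponential of rate λk/n, stationarity gives P(W > s) - P(W > t) = (λk/n) ∫ₛᵗ P(W ≤ u <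
X) du (`IsStationary.workload_sub`). Averaged over the k queues, only the n + m chosen queues
contribute. For them the event says that the job is in service at time u and that fewer than n of
the other virtual jobs are completed (`sum_workloadAfter_sub`); its probability is `inService`.

Asymptotic independence concerns T = W + E only, not W. Memorylessness bridges the gap: up to
factors e^h - 1 and 1 - e^(-h), being in service at u is squeezed between T ∈ (u - h, u] and T ∈ (u,
u + h]. Taking k → ∞ and then h → 0 gives the limit -H'(u) · `binTail (n + m - 1) n (H u)` wherever
H is differentiable (`tendsto_inService`). This is almost everywhere, because T has density at most
1 and so H is 1-Lipschitz. The same argument without a constraint on the other jobs gives P(W > u) →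
H(u) + H'(u) (`tendsto_workload`).

With Φ = `intTail`, an antiderivative of the binomial tail, the limiting balance says that H + H' -
αΦ(H) is constant on the nonnegative points of differentiability. Since 0 ≤ H + H' ≤ H → 0 and Φ(0)
= 0, the constant is 0. The equation H' = -H + αΦ(H) then extends to every t ≥ 0, as H is absolutely
continuous and the right side is continuous.

Since Φ(x) = O(x²), the nonlinear term is negligible once H is small and H = O(e^(-t)). The batch
tail is the binomial tail of H, of order at most H^(m+1), hence O(e^(-(m+1)t)). The replication tail
is at least e^(-dt) when λ < 1. That λ < 1 is a consequence: for λ ≥ 1 the equation with H(0) = 1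
would force H = 1 forever. -/

namespace MDSQueue

/-! ### Binomial tails -/

/-- The probability that fewer than `n` of `M` independent events of probability `1 - x` happen. -/
noncomputable def binTail (M n : ℕ) (x : ℝ) : ℝ :=
  ∑ a ∈ Finset.range n, (M.choose a : ℝ) * (1 - x) ^ a * x ^ (M - a)

/-- The polynomial `∑ i < n, (n-1 choose i) (-1) ^ i x ^ (r + i + 1) / (r + i + 1)`, an antiderivative
of `x ^ r * (1 - x) ^ (n - 1)`. -/
noncomputable def altSum (n r : ℕ) (x : ℝ) : ℝ :=
  ∑ i ∈ Finset.range n, ((n - 1).choose i : ℝ) * (-1) ^ i * (1 / ((r : ℝ) + i + 1)) * x ^ (r + i + 1)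

-- Derivatives of consecutive Bernstein polynomials telescope.
open Polynomial in
lemma derivative_sum_bernstein (M n : ℕ) :
    derivative (∑ a ∈ Finset.range (n + 1), bernsteinPolynomial ℝ M a)
      = -(M : ℝ[X]) * bernsteinPolynomial ℝ (M - 1) n := by
  induction n with
  | zero => simp [bernsteinPolynomial.derivative_zero]
  | succ n ih =>
    rw [Finset.sum_range_succ, derivative_add, ih, bernsteinPolynomial.derivative_succ]
    ring

lemma binTail_eq_eval (M n : ℕ) (x : ℝ) :
    binTail M n x
      = (∑ a ∈ Finset.range n, bernsteinPolynomial ℝ M a).eval (1 - x) := by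
  simp [binTail, Polynomial.eval_finsetSum, bernsteinPolynomial]

lemma hasDerivAt_binTail (M n : ℕ) (x : ℝ) :
    HasDerivAt (binTail M (n + 1))
      ((M : ℝ) * ((M - 1).choose n * (1 - x) ^ n * x ^ (M - 1 - n))) x := by
  have h1 := ((∑ a ∈ Finset.range (n + 1), bernsteinPolynomial ℝ M a).hasDerivAt (1 - x))
  rw [derivative_sum_bernstein] at h1
  have h2 : HasDerivAt (fun y : ℝ => 1 - y) (-1) x := by
    simpa using (hasDerivAt_id x).const_sub 1
  have h3 := h1.comp x h2
  have : binTail M (n + 1)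
      = (fun y => (∑ a ∈ Finset.range (n + 1), bernsteinPolynomial ℝ M a).eval y)
        ∘ fun y : ℝ => 1 - y := by
    ext y; rw [binTail_eq_eval]; rfl
  rw [this]
  refine h3.congr_deriv ?_
  simp [bernsteinPolynomial]

lemma hasDerivAt_altSum (n r : ℕ) (x : ℝ) :
    HasDerivAt (altSum (n + 1) r) (x ^ r * (1 - x) ^ n) x := by
  have h : HasDerivAt (altSum (n + 1) r)
      (∑ i ∈ Finset.range (n + 1), (n.choose i : ℝ) * (-1) ^ i * x ^ (r + i)) x := by
    unfold altSum
    refine HasDerivAt.fun_sum fun i _ => ?_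
    have := (hasDerivAt_pow (r + i + 1) x).const_mul
      ((n.choose i : ℝ) * (-1) ^ i * (1 / ((r : ℝ) + i + 1)))
    refine this.congr_deriv ?_
    have hp : ((r : ℝ) + i + 1) ≠ 0 := by positivity
    push_cast
    field_simp
  refine h.congr_deriv ?_
  rw [show (1 - x) = (-x + 1) by ring, add_pow, Finset.mul_sum]
  refine Finset.sum_congr rfl fun i _ => ?_
  rw [neg_pow x i]
  ring

lemma altSum_zero (n r : ℕ) : altSum n r 0 = 0 := by simp [altSum]

lemma binTail_zero {M n : ℕ} (h : n ≤ M) : binTail M n 0 = 0 := by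
  refine Finset.sum_eq_zero fun a ha => ?_
  have : M - a ≠ 0 := by have := Finset.mem_range.1 ha; omega
  simp [this]

lemma binTail_one {M n : ℕ} (h : 1 ≤ n) : binTail M n 1 = 1 := by
  unfold binTail
  rw [Finset.sum_eq_single 0]
  · simp
  · intro b _ hb; simp [hb]
  · intro h0; exact absurd (Finset.mem_range.2 h) h0

/-- Both sides vanish at 0, and both have a derivative proportional to x^r (1 - x)^(n-1), with the
same constant. -/
lemma binTail_eq_altSum {n : ℕ} (hn : 1 ≤ n) (r : ℕ) (x : ℝ) :
    binTail (n + r) n x = ((n : ℝ) + r) * ((n + r - 1).choose (n - 1) : ℝ) * altSum n r x := by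
  obtain ⟨n, rfl⟩ : ∃ k, n = k + 1 := ⟨n - 1, by omega⟩
  simp only [Nat.add_sub_cancel]
  set c : ℝ := ((n + 1 : ℕ) + (r : ℝ)) * ((n + 1 + r - 1).choose n : ℝ) with hc
  have hd : ∀ y, HasDerivAt (fun y => binTail (n + 1 + r) (n + 1) y - c * altSum (n + 1) r y) 0 y := by
    intro y
    have := (hasDerivAt_binTail (n + 1 + r) n y).sub ((hasDerivAt_altSum n r y).const_mul c)
    refine this.congr_deriv ?_
    have : n + 1 + r - 1 - n = r := by omega
    rw [this, hc]; push_cast; ring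
  have := is_const_of_deriv_eq_zero (fun y => (hd y).differentiableAt) (fun y => (hd y).deriv) x 0
  simp only [binTail_zero (show n + 1 ≤ n + 1 + r by omega), altSum_zero] at this
  linarith

/-- The terms beyond M vanish and the rest is the binomial theorem. Later this covers the case of no
constraint on the other jobs. -/
lemma binTail_eq_one {M n : ℕ} (h : M < n) (x : ℝ) : binTail M n x = 1 := by
  have h1 : binTail M n x = binTail M (M + 1) x := by
    unfold binTail
    symm
    refine Finset.sum_subset (Finset.range_mono h) fun a _ ha => ?_
    rw [Finset.mem_range, not_lt] at ha
    simp [Nat.choose_eq_zero_of_lt ha]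
  have h2 := add_pow (1 - x) x M
  rw [sub_add_cancel, one_pow] at h2
  rw [h1, binTail]
  refine Eq.trans ?_ h2.symm
  exact Finset.sum_congr rfl fun i _ => by ring

lemma binTail_nonneg (M n : ℕ) {x : ℝ} (h0 : 0 ≤ x) (h1 : x ≤ 1) : 0 ≤ binTail M n x :=
  Finset.sum_nonneg fun a _ => by
    have : 0 ≤ 1 - x := by linarith
    positivity

lemma binTail_le_one (M n : ℕ) {x : ℝ} (h0 : 0 ≤ x) (h1 : x ≤ 1) : binTail M n x ≤ 1 := by
  rw [← binTail_eq_one (show M < n + M + 1 by omega) x]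
  refine Finset.sum_le_sum_of_subset_of_nonneg (Finset.range_mono (by omega)) fun a _ _ => ?_
  have : 0 ≤ 1 - x := by linarith
  positivity

/-- Bound on a polynomial on `[0, 1]` by its lowest power. -/
lemma sum_mul_pow_le (n r : ℕ) (c : ℕ → ℝ) {x : ℝ} (h0 : 0 ≤ x) (h1 : x ≤ 1) :
    ∑ i ∈ Finset.range n, c i * x ^ (r + i) ≤ (∑ i ∈ Finset.range n, |c i|) * x ^ r := by
  rw [Finset.sum_mul]
  refine Finset.sum_le_sum fun i _ => ?_
  calc c i * x ^ (r + i) ≤ |c i| * x ^ (r + i) := by gcongr; exact le_abs_self _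
    _ ≤ |c i| * x ^ r := by
      gcongr 1
      exact pow_le_pow_of_le_one h0 h1 (by omega)

lemma exists_altSum_le (n r : ℕ) :
    ∃ K : ℝ, 0 ≤ K ∧ ∀ x : ℝ, 0 ≤ x → x ≤ 1 → altSum n r x ≤ K * x ^ (r + 1) := by
  refine ⟨∑ i ∈ Finset.range n, |((n - 1).choose i : ℝ) * (-1) ^ i * (1 / ((r : ℝ) + i + 1))|,
    Finset.sum_nonneg fun _ _ => abs_nonneg _, fun x h0 h1 => ?_⟩
  refine le_trans (le_of_eq ?_) (sum_mul_pow_le n (r + 1) _ h0 h1)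
  refine Finset.sum_congr rfl fun i _ => ?_
  rw [show r + 1 + i = r + i + 1 by ring]

/-- The antiderivative of the binomial tail `binTail (n + m - 1) n`. -/
noncomputable def intTail (n m : ℕ) (x : ℝ) : ℝ :=
  ((n : ℝ) + m - 1) * ((n + m - 2).choose (n - 1) : ℝ)
    * ∑ i ∈ Finset.range n, ((n - 1).choose i : ℝ) * (-1) ^ i
      * (1 / (((m : ℝ) + i) * ((m : ℝ) + i + 1))) * x ^ (m + i + 1)

/-- Partial fractions 1/((m+i)(m+i+1)) = 1/(m+i) - 1/(m+i+1) split the sum into two alternating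
sums. This form gives the value at 1 and the quadratic bound without handling alternating signs. -/
lemma intTail_eq {n m : ℕ} (hn : 1 ≤ n) (hm : 1 ≤ m) (x : ℝ) :
    intTail n m x = x * binTail (n + m - 1) n x - (m / ((n : ℝ) + m)) * binTail (n + m) n x := by
  obtain ⟨r, rfl⟩ : ∃ k, m = k + 1 := ⟨m - 1, by omega⟩
  have h1 : n + (r + 1) - 1 = n + r := by omega
  have h2 : n + (r + 1) - 2 = n + r - 1 := by omega
  rw [h1, binTail_eq_altSum hn, binTail_eq_altSum hn, intTail, h1, h2]
  have hch : ((r : ℝ) + 1) * ((n + r).choose (n - 1) : ℝ)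
      = ((n : ℝ) + r) * ((n + r - 1).choose (n - 1) : ℝ) := by
    obtain ⟨k, rfl⟩ : ∃ k, n = k + 1 := ⟨n - 1, by omega⟩
    have := Nat.choose_mul_succ_eq (k + r) k
    rw [show k + r + 1 - k = r + 1 by omega] at this
    simp only [Nat.add_sub_cancel, show k + 1 + r = k + r + 1 by ring]
    have h := congrArg (Nat.cast (R := ℝ)) this
    push_cast at h ⊢
    linarith
  have hnr : (n : ℝ) + (r + 1) ≠ 0 := by positivity
  have h3 : (((r + 1 : ℕ) : ℝ) / ((n : ℝ) + ((r + 1 : ℕ) : ℝ)))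
      * (((n : ℝ) + ((r + 1 : ℕ) : ℝ)) * ((n + r).choose (n - 1) : ℝ) * altSum n (r + 1) x)
      = ((n : ℝ) + r) * ((n + r - 1).choose (n - 1) : ℝ) * altSum n (r + 1) x := by
    rw [← hch]; push_cast; field_simp
  rw [h3]
  have h4 : ∑ i ∈ Finset.range n, ((n - 1).choose i : ℝ) * (-1) ^ i
      * (1 / ((((r + 1 : ℕ) : ℝ) + i) * (((r + 1 : ℕ) : ℝ) + i + 1))) * x ^ (r + 1 + i + 1)
      = x * altSum n r x - altSum n (r + 1) x := by
    unfold altSum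
    rw [Finset.mul_sum, ← Finset.sum_sub_distrib]
    refine Finset.sum_congr rfl fun i _ => ?_
    have e1 : (r : ℝ) + i + 1 ≠ 0 := by positivity
    have e2 : (r : ℝ) + 1 + i + 1 ≠ 0 := by positivity
    have e3 : (r : ℝ) + 1 + i ≠ 0 := by positivity
    push_cast
    rw [show r + 1 + i + 1 = (r + i + 1) + 1 by ring, pow_succ]
    field_simp
    ring
  rw [h4]
  push_cast
  ring

lemma intTail_one {n m : ℕ} (hn : 1 ≤ n) (hm : 1 ≤ m) : intTail n m 1 = n / ((n : ℝ) + m) := by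
  rw [intTail_eq hn hm, binTail_one hn, binTail_one hn]
  have : (n : ℝ) + m ≠ 0 := by positivity
  field_simp
  ring

lemma intTail_zero (n m : ℕ) : intTail n m 0 = 0 := by simp [intTail]

lemma hasDerivAt_intTail {n m : ℕ} (hn : 1 ≤ n) (hm : 1 ≤ m) (x : ℝ) :
    HasDerivAt (intTail n m) (binTail (n + m - 1) n x) x := by
  obtain ⟨r, rfl⟩ : ∃ k, m = k + 1 := ⟨m - 1, by omega⟩
  have h1 : n + (r + 1) - 1 = n + r := by omega
  have h2 : n + (r + 1) - 2 = n + r - 1 := by omega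
  rw [h1, binTail_eq_altSum hn]
  have h3 : intTail n (r + 1) = fun x => ((n : ℝ) + r) * ((n + r - 1).choose (n - 1) : ℝ)
      * ∑ i ∈ Finset.range n, ((n - 1).choose i : ℝ) * (-1) ^ i
      * (1 / ((((r + 1 : ℕ) : ℝ) + i) * (((r + 1 : ℕ) : ℝ) + i + 1))) * x ^ (r + 1 + i + 1) := by
    ext y; rw [intTail, h2]; push_cast; ring
  rw [h3]
  refine HasDerivAt.const_mul _ ?_
  unfold altSum
  refine HasDerivAt.fun_sum fun i _ => ?_
  have := (hasDerivAt_pow (r + 1 + i + 1) x).const_mul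
      (((n - 1).choose i : ℝ) * (-1) ^ i
        * (1 / ((((r + 1 : ℕ) : ℝ) + i) * (((r + 1 : ℕ) : ℝ) + i + 1))))
  refine this.congr_deriv ?_
  have e1 : (r : ℝ) + i + 1 ≠ 0 := by positivity
  have e2 : (r : ℝ) + 1 + i + 1 ≠ 0 := by positivity
  have e3 : (r : ℝ) + 1 + i ≠ 0 := by positivity
  rw [show r + 1 + i + 1 - 1 = r + i + 1 by omega]
  push_cast
  field_simp
  ring

lemma continuous_intTail (n m : ℕ) : Continuous (intTail n m) := by
  unfold intTail; fun_prop

/-- The subtracted term in `intTail_eq` is nonnegative, and the binomial tail multiplying x is O(x)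
because m ≥ 1. A quadratic bound is all that the decay argument needs. -/
lemma exists_intTail_le {n m : ℕ} (hn : 1 ≤ n) (hm : 1 ≤ m) :
    ∃ K : ℝ, 0 ≤ K ∧ ∀ x : ℝ, 0 ≤ x → x ≤ 1 → intTail n m x ≤ K * x ^ 2 := by
  obtain ⟨r, rfl⟩ : ∃ k, m = k + 1 := ⟨m - 1, by omega⟩
  obtain ⟨K, hK0, hK⟩ := exists_altSum_le n r
  set c : ℝ := ((n : ℝ) + r) * ((n + r - 1).choose (n - 1) : ℝ) with hc
  have hc0 : 0 ≤ c := by positivity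
  refine ⟨c * K, by positivity, fun x h0 h1 => ?_⟩
  rw [intTail_eq hn hm]
  have h2 := binTail_nonneg (n + (r + 1)) n h0 h1
  have h3 : 0 ≤ ((r + 1 : ℕ) : ℝ) / ((n : ℝ) + ((r + 1 : ℕ) : ℝ)) := by positivity
  have h4 : binTail (n + (r + 1) - 1) n x ≤ c * K * x := by
    rw [show n + (r + 1) - 1 = n + r by omega, binTail_eq_altSum hn, ← hc, mul_assoc c]
    refine mul_le_mul_of_nonneg_left ((hK x h0 h1).trans ?_) hc0
    gcongr
    exact pow_le_of_le_one h0 h1 (by omega)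
  have := mul_nonneg h3 h2
  nlinarith [mul_le_mul_of_nonneg_left h4 h0]

/-! ### The differential equation -/

/-- A solution of `H' = -H + α φ(H)` that vanishes at infinity, with `φ` at most quadratic,
decays like `e ^ (-t)`. -/
lemma exists_exp_mul_le_of_ode {H φ : ℝ → ℝ} {α K : ℝ} (hα : 0 ≤ α) (hK : 0 ≤ K)
    (hφ : ∀ x, 0 ≤ x → x ≤ 1 → φ x ≤ K * x ^ 2)
    (hH0 : ∀ t, 0 ≤ H t) (hH1 : ∀ t, H t ≤ 1) (hlim : Tendsto H atTop (𝓝 0))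
    (hode : ∀ t, 0 ≤ t → HasDerivWithinAt H (-H t + α * φ (H t)) (Ici 0) t) :
    ∃ C : ℝ, 0 ≤ C ∧ ∀ᶠ t in atTop, Real.exp t * H t ≤ C := by
  have hd : ∀ t, 0 < t → HasDerivAt H (-H t + α * φ (H t)) t := fun t ht =>
    (hode t ht.le).hasDerivAt (Ici_mem_nhds ht)
  have hαK : 0 ≤ α * K := by positivity
  obtain ⟨T, hT0, hT⟩ : ∃ T : ℝ, 0 < T ∧ ∀ t, T ≤ t → α * K * H t ≤ 1 / 2 := by
    have h1 : Tendsto (fun t => α * K * H t) atTop (𝓝 (α * K * 0)) := hlim.const_mul _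
    rw [mul_zero] at h1
    have h2 := (h1.eventually (ge_mem_nhds (show (0 : ℝ) < 1 / 2 by norm_num))).and
      (eventually_gt_atTop 0)
    obtain ⟨T, hT⟩ := eventually_atTop.1 h2
    exact ⟨max T 1, by positivity, fun t ht => (hT t ((le_max_left _ _).trans ht)).1⟩
  have hcontH : ContinuousOn H (Ici T) := fun t ht =>
    (hd t (hT0.trans_le ht)).continuousAt.continuousWithinAt
  have hbd : ∀ t, α * φ (H t) ≤ α * K * H t * H t := fun t => by
    have := mul_le_mul_of_nonneg_left (hφ (H t) (hH0 t) (hH1 t)) hα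
    linarith [this, show α * (K * H t ^ 2) = α * K * H t * H t by ring]
  -- First pass, with half the expected rate: past T the nonlinear term is at most H/2, so H' ≤
  -- -H/2.
  have hA : AntitoneOn (fun t => Real.exp (t / 2) * H t) (Ici T) := by
    have hder : ∀ t, T < t → HasDerivAt (fun t => Real.exp (t / 2) * H t)
        (Real.exp (t / 2) * (1 / 2) * H t + Real.exp (t / 2) * (-H t + α * φ (H t))) t := by
      intro t ht
      have h1 : HasDerivAt (fun t : ℝ => Real.exp (t / 2)) (Real.exp (t / 2) * (1 / 2)) t :=
        ((hasDerivAt_id t).div_const 2).exp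
      exact h1.mul (hd t (hT0.trans ht))
    refine antitoneOn_of_deriv_nonpos (convex_Ici T) ?_ ?_ ?_
    · exact (by fun_prop : Continuous fun t : ℝ => Real.exp (t / 2)).continuousOn.mul hcontH
    · intro t ht
      rw [interior_Ici] at ht
      exact (hder t ht).differentiableAt.differentiableWithinAt
    · intro t ht
      rw [interior_Ici] at ht
      rw [(hder t ht).deriv]
      have h1 := hbd t
      have h2 := mul_le_mul_of_nonneg_right (hT t (le_of_lt ht)) (hH0 t)
      have h3 : (1 / 2) * H t + (-H t + α * φ (H t)) ≤ 0 := by linarith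
      have h4 := Real.exp_pos (t / 2)
      nlinarith [mul_nonneg h4.le (neg_nonneg.2 h3)]
  set c := Real.exp (T / 2) * H T with hc
  have hc0 : 0 ≤ c := mul_nonneg (Real.exp_pos _).le (hH0 T)
  have hHle : ∀ t, T ≤ t → H t ≤ c * Real.exp (-t / 2) := by
    intro t ht
    have h1 : Real.exp (t / 2) * H t ≤ c := hA (mem_Ici.2 le_rfl) (mem_Ici.2 ht) ht
    have h2 := mul_le_mul_of_nonneg_right h1 (Real.exp_pos (-t / 2)).le
    have h3 : Real.exp (t / 2) * Real.exp (-t / 2) = 1 := by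
      rw [← Real.exp_add, show t / 2 + -t / 2 = 0 by ring, Real.exp_zero]
    calc H t = Real.exp (t / 2) * Real.exp (-t / 2) * H t := by rw [h3, one_mul]
      _ = Real.exp (t / 2) * H t * Real.exp (-t / 2) := by ring
      _ ≤ _ := h2
  set a := α * K * c with ha
  have ha0 : 0 ≤ a := by positivity
  -- Second pass. The crude decay makes the nonlinear term at most a e^(-t/2) H, an integrable
  -- correction to the rate; the exponent is an antiderivative of 1 - a e^(-t/2). It exceeds t by a
  -- nonnegative amount, so e^t H is bounded too.
  have hB : AntitoneOn (fun t => Real.exp (t + 2 * a * Real.exp (-t / 2)) * H t) (Ici T) := by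
    have hder : ∀ t, T < t → HasDerivAt (fun t => Real.exp (t + 2 * a * Real.exp (-t / 2)) * H t)
        (Real.exp (t + 2 * a * Real.exp (-t / 2)) * (1 + 2 * a * (Real.exp (-t / 2) * (-1 / 2))) * H t
          + Real.exp (t + 2 * a * Real.exp (-t / 2)) * (-H t + α * φ (H t))) t := by
      intro t ht
      have h0 : HasDerivAt (fun t : ℝ => Real.exp (-t / 2)) (Real.exp (-t / 2) * (-1 / 2)) t :=
        ((hasDerivAt_id t).neg.div_const 2).exp
      have h1 := ((hasDerivAt_id t).add (h0.const_mul (2 * a))).exp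
      exact h1.mul (hd t (hT0.trans ht))
    refine antitoneOn_of_deriv_nonpos (convex_Ici T) ?_ ?_ ?_
    · exact (by fun_prop : Continuous fun t : ℝ =>
        Real.exp (t + 2 * a * Real.exp (-t / 2))).continuousOn.mul hcontH
    · intro t ht
      rw [interior_Ici] at ht
      exact (hder t ht).differentiableAt.differentiableWithinAt
    · intro t ht
      rw [interior_Ici] at ht
      rw [(hder t ht).deriv]
      have h1 := hbd t
      have h2 := mul_le_mul_of_nonneg_left (hHle t (le_of_lt ht)) hαK
      have h2' := mul_le_mul_of_nonneg_right h2 (hH0 t)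
      have h3 : (1 + 2 * a * (Real.exp (-t / 2) * (-1 / 2))) * H t + (-H t + α * φ (H t)) ≤ 0 := by
        have e : α * K * (c * Real.exp (-t / 2)) * H t = a * Real.exp (-t / 2) * H t := by
          rw [ha]; ring
        rw [e] at h2'
        linarith
      have h4 := Real.exp_pos (t + 2 * a * Real.exp (-t / 2))
      nlinarith [mul_nonneg h4.le (neg_nonneg.2 h3)]
  refine ⟨Real.exp (T + 2 * a * Real.exp (-T / 2)) * H T,
    mul_nonneg (Real.exp_pos _).le (hH0 T), ?_⟩
  filter_upwards [eventually_ge_atTop T] with t ht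
  refine le_trans ?_ (hB (mem_Ici.2 le_rfl) (mem_Ici.2 ht) ht)
  refine mul_le_mul_of_nonneg_right (Real.exp_le_exp.2 ?_) (hH0 t)
  have := Real.exp_pos (-t / 2)
  nlinarith [mul_nonneg ha0 this.le]

/-- If `1` is a supersolution of `H' = g(H)` in the sense that `g x ≥ -α (1 - x)` below `1`, then a
solution that starts at `1` stays there. -/
lemma eq_one_of_ode {H g : ℝ → ℝ} {α : ℝ}
    (hg : ∀ x, 0 ≤ x → x ≤ 1 → -(α * (1 - x)) ≤ g x)
    (hH0 : ∀ t, 0 ≤ H t) (hH1 : ∀ t, H t ≤ 1) (hzero : H 0 = 1)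
    (hode : ∀ t, 0 ≤ t → HasDerivWithinAt H (g (H t)) (Ici 0) t) {t : ℝ} (ht : 0 ≤ t) :
    H t = 1 := by
  -- Grönwall for the nonnegative gap 1 - H, which starts at 0 and grows at rate at most α.
  have hA : AntitoneOn (fun t => Real.exp (-α * t) * (1 - H t)) (Ici 0) := by
    have hder : ∀ t, 0 < t → HasDerivAt (fun t => Real.exp (-α * t) * (1 - H t))
        (Real.exp (-α * t) * (-α * 1) * (1 - H t) + Real.exp (-α * t) * (-g (H t))) t := by
      intro t ht
      have h1 := ((hasDerivAt_id t).const_mul (-α)).exp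
      exact h1.mul (((hode t ht.le).hasDerivAt (Ici_mem_nhds ht)).const_sub 1)
    refine antitoneOn_of_deriv_nonpos (convex_Ici 0) ?_ ?_ ?_
    · refine (by fun_prop : Continuous fun t : ℝ => Real.exp (-α * t)).continuousOn.mul
        (continuousOn_const.sub fun t ht => (hode t ht).continuousWithinAt)
    · intro t ht
      rw [interior_Ici] at ht
      exact (hder t ht).differentiableAt.differentiableWithinAt
    · intro t ht
      rw [interior_Ici] at ht
      rw [(hder t ht).deriv]
      have h1 := hg (H t) (hH0 t) (hH1 t)
      have h4 := Real.exp_pos (-α * t)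
      have h3 : -α * 1 * (1 - H t) + -g (H t) ≤ 0 := by linarith
      nlinarith [mul_nonneg h4.le (neg_nonneg.2 h3)]
  have h1 := hA (mem_Ici.2 le_rfl) (mem_Ici.2 ht) ht
  simp only [hzero, sub_self, mul_zero] at h1
  have h2 : 1 - H t ≤ 0 := by
    by_contra h
    exact absurd h1 (not_le.2 (mul_pos (Real.exp_pos _) (not_le.1 h)))
  linarith [hH1 t]

/-! ### Counting events under product measures -/

/-- Under a product measure, the law of the number of events `x i ∈ A i`, `i ∈ s`, together with
events on the coordinates outside `s`. -/
lemma pi_card_filter_lt {ι : Type*} [Fintype ι] [DecidableEq ι] (μ : ι → Measure ℝ)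
    [∀ i, IsProbabilityMeasure (μ i)] (s : Finset ι) {A I : ι → Set ℝ}
    [∀ x : ι → ℝ, DecidablePred fun i => x i ∈ A i]
    (hA : ∀ i, MeasurableSet (A i)) (hI : ∀ i, MeasurableSet (I i)) (c : ℕ) :
    Measure.pi μ {x | (∀ i ∉ s, x i ∈ I i) ∧ (s.filter fun i => x i ∈ A i).card < c}
      = (∏ i ∈ sᶜ, μ i (I i)) * ∑ S ∈ s.powerset.filter (fun S => S.card < c),
          ∏ i ∈ s, if i ∈ S then μ i (A i) else μ i (A i)ᶜ := by
  let B : Finset ι → ι → Set ℝ := fun S i => if i ∈ s then (if i ∈ S then A i else (A i)ᶜ) else I i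
  have hB : ∀ S i, MeasurableSet (B S i) := by
    intro S i
    simp only [B]
    split_ifs
    exacts [hA i, (hA i).compl, hI i]
  have hset : {x : ι → ℝ | (∀ i ∉ s, x i ∈ I i) ∧ (s.filter fun i => x i ∈ A i).card < c}
      = ⋃ S ∈ s.powerset.filter (fun S => S.card < c), Set.pi univ (B S) := by
    ext x
    simp only [mem_ofPred_eq, mem_iUnion, Set.mem_pi, mem_univ, true_imp_iff, Finset.mem_filter,
      Finset.mem_powerset, exists_prop]
    constructor
    · rintro ⟨h1, h2⟩
      refine ⟨s.filter fun i => x i ∈ A i, ⟨Finset.filter_subset _ _, h2⟩, fun i => ?_⟩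
      by_cases hi : i ∈ s
      · by_cases hx : x i ∈ A i <;> simp [B, hi, hx]
      · simpa [B, hi] using h1 i hi
    · rintro ⟨S, ⟨hS, hc⟩, h⟩
      refine ⟨fun i hi => by simpa [B, hi] using h i, ?_⟩
      have : (s.filter fun i => x i ∈ A i) = S := by
        ext i
        rw [Finset.mem_filter]
        have hi := h i
        constructor
        · rintro ⟨his, hx⟩
          by_contra hn
          simp [B, his, hn, hx] at hi
        · intro hiS
          refine ⟨hS hiS, by simpa [B, hS hiS, hiS] using hi⟩
      rwa [this]
  rw [hset, measure_biUnion_finset]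
  · rw [Finset.mul_sum]
    refine Finset.sum_congr rfl fun S _ => ?_
    rw [Measure.pi_pi, ← Finset.prod_mul_prod_compl s, mul_comm]
    congr 1
    · refine Finset.prod_congr rfl fun i hi => ?_
      rw [Finset.mem_compl] at hi
      simp [B, hi]
    · refine Finset.prod_congr rfl fun i hi => ?_
      simp only [B, hi, if_true]
      split_ifs <;> rfl
  · intro S hS S' hS' hne
    rw [Function.onFun, Set.disjoint_left]
    intro x hx hx'
    apply hne
    simp only [Finset.coe_filter, Finset.mem_powerset, mem_ofPred_eq] at hS hS'
    ext i
    have h1 := hx i (mem_univ i)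
    have h2 := hx' i (mem_univ i)
    by_cases hi : i ∈ s
    · by_cases a : i ∈ S <;> by_cases b : i ∈ S' <;> simp_all [B]
    · exact ⟨fun h => absurd (hS.1 h) hi, fun h => absurd (hS'.1 h) hi⟩
  · intro S _
    exact MeasurableSet.univ_pi (hB S)

lemma sum_powerset_card_lt_eq_binTail {ι : Type*} [DecidableEq ι] (s : Finset ι) (c : ℕ) (x : ℝ) :
    ∑ S ∈ s.powerset.filter (fun S => S.card < c), ∏ i ∈ s, (if i ∈ S then 1 - x else x)
      = binTail s.card c x := by
  have h1 : ∀ S ∈ s.powerset, (if S.card < c then ∏ i ∈ s, (if i ∈ S then 1 - x else x) else 0)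
      = (fun a => if a < c then (1 - x) ^ a * x ^ (s.card - a) else 0) S.card := by
    intro S hS
    have hS := Finset.mem_powerset.1 hS
    simp only
    split_ifs
    · rw [Finset.prod_ite, Finset.prod_const, Finset.prod_const]
      have e1 : s.filter (fun i => i ∈ S) = S := by
        ext i; simp only [Finset.mem_filter]; exact ⟨fun h => h.2, fun h => ⟨hS h, h⟩⟩
      have e2 : s.filter (fun i => i ∉ S) = s \ S := by
        ext i; simp
      rw [e1, e2, Finset.card_sdiff_of_subset hS]
    · rfl
  rw [Finset.sum_filter, Finset.sum_congr rfl h1,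
    Finset.sum_powerset_apply_card (fun a => if a < c then (1 - x) ^ a * x ^ (s.card - a) else 0), binTail]
  simp only [nsmul_eq_mul, mul_ite, mul_zero]
  rw [← Finset.sum_filter]
  have h2 : (Finset.range (s.card + 1)).filter (fun a => a < c) ⊆ Finset.range c := by
    intro a; simp
  refine (Finset.sum_congr rfl fun a _ => (mul_assoc _ _ _).symm).trans
    (Finset.sum_subset h2 fun a ha hn => ?_)
  have : s.card < a := by
    simp only [Finset.mem_filter, Finset.mem_range, not_and] at hn ha
    by_contra h
    exact hn (by omega) ha
  simp [Nat.choose_eq_zero_of_lt this]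

lemma pi_real_card_filter_lt {ι : Type*} [Fintype ι] [DecidableEq ι] (ν : Measure ℝ)
    [IsProbabilityMeasure ν] (s : Finset ι) {I : Set ℝ} (hI : MeasurableSet I) (u : ℝ) (c : ℕ) :
    (Measure.pi fun _ : ι => ν).real
        {x | (∀ i ∉ s, x i ∈ I) ∧ (s.filter fun i => x i ≤ u).card < c}
      = ν.real I ^ (sᶜ).card * binTail s.card c (ν.real (Ioi u)) := by
  have h := pi_card_filter_lt (fun _ : ι => ν) s (A := fun _ => Iic u) (I := fun _ => I)
    (fun _ => measurableSet_Iic) (fun _ => hI) c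
  have h1 : ν.real (Iic u) = 1 - ν.real (Ioi u) := by
    rw [← compl_Iic, measureReal_compl measurableSet_Iic]; simp
  rw [Measure.real]
  simp only [mem_Iic, compl_Iic] at h
  rw [h, ENNReal.toReal_mul, Finset.prod_const, ENNReal.toReal_pow, ENNReal.toReal_sum,
    ← sum_powerset_card_lt_eq_binTail]
  · congr 1
    refine Finset.sum_congr rfl fun S _ => ?_
    rw [ENNReal.toReal_prod]
    refine Finset.prod_congr rfl fun i _ => ?_
    split_ifs
    exacts [h1, rfl]
  · intro S _
    refine ENNReal.prod_ne_top fun i _ => ?_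
    split_ifs <;> exact measure_ne_top _ _

/-! ### The exponential law -/

lemma expMeasure_real_Ioi {r : ℝ} (hr : 0 < r) (x : ℝ) :
    (expMeasure r).real (Ioi x) = Real.exp (-(r * max 0 x)) := by
  have := isProbabilityMeasure_expMeasure hr
  rw [← compl_Iic, measureReal_compl measurableSet_Iic, ← cdf_eq_real, cdf_expMeasure_eq hr,
    probReal_univ]
  split_ifs with h
  · rw [max_eq_right h]; ring
  · rw [max_eq_left (not_le.1 h).le]; simp

lemma expMeasure_real_Ioc {r : ℝ} (hr : 0 < r) {a b : ℝ} (hab : a ≤ b) :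
    (expMeasure r).real (Ioc a b) = Real.exp (-(r * max 0 a)) - Real.exp (-(r * max 0 b)) := by
  have := isProbabilityMeasure_expMeasure hr
  rw [← expMeasure_real_Ioi hr, ← expMeasure_real_Ioi hr, ← Ioi_sdiff_Ioi,
    measureReal_sdiff (Ioi_subset_Ioi hab) measurableSet_Ioi]

/-- The density is at most 1. This is the source of the Lipschitz bound on H. -/
lemma expMeasure_real_Ioc_le {a b : ℝ} (hab : a ≤ b) : (expMeasure 1).real (Ioc a b) ≤ b - a := by
  rw [expMeasure_real_Ioc one_pos hab, one_mul, one_mul]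
  have h0 : (0 : ℝ) ≤ max 0 a := le_max_left _ _
  have hm : max 0 a ≤ max 0 b := max_le_max le_rfl hab
  have h1 : max 0 b - max 0 a ≤ b - a := by
    rcases le_total 0 a with h | h <;> rcases le_total 0 b with h' | h' <;>
      simp [h, h'] <;> linarith
  have h2 : Real.exp (-max 0 b) = Real.exp (-max 0 a) * Real.exp (-(max 0 b - max 0 a)) := by
    rw [← Real.exp_add]; congr 1; ring
  have h3 := Real.add_one_le_exp (-(max 0 b - max 0 a))
  have h4 : Real.exp (-max 0 a) ≤ 1 := Real.exp_le_one_iff.2 (by linarith)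
  have h5 := Real.exp_pos (-max 0 a)
  rw [h2]
  nlinarith

/-- Memorylessness: a job in service at u finishes within h with probability 1 - e^(-h). A job with
w > u can only add to the right side. -/
lemma expMeasure_real_residual_le (w u : ℝ) {h : ℝ} (hh : 0 < h) :
    (1 - Real.exp (-h)) * (expMeasure 1).real {e | w ≤ u ∧ u < w + e}
      ≤ (expMeasure 1).real {e | w + e ∈ Ioc u (u + h)} := by
  by_cases hw : w ≤ u
  · have e1 : {e | w ≤ u ∧ u < w + e} = Ioi (u - w) := by
      ext e; simp only [hw, true_and, mem_ofPred_eq, mem_Ioi]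
      constructor <;> intro <;> linarith
    have e2 : {e | w + e ∈ Ioc u (u + h)} = Ioc (u - w) (u - w + h) := by
      ext e; simp only [mem_ofPred_eq, mem_Ioc]
      constructor <;> rintro ⟨_, _⟩ <;> constructor <;> linarith
    rw [e1, e2, expMeasure_real_Ioi one_pos, expMeasure_real_Ioc one_pos (by linarith),
      max_eq_right (by linarith), max_eq_right (by linarith),
      show -(1 * (u - w + h)) = -h + -(1 * (u - w)) by ring, Real.exp_add]
    apply le_of_eq; ring
  · simp [hw]

/-- The backward counterpart. It is an equality for w ≤ u - h; service that starts inside (u - h, u]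
leaves less room to finish by u. -/
lemma le_expMeasure_real_residual (w u : ℝ) {h : ℝ} (hh : 0 < h) :
    (expMeasure 1).real {e | w + e ∈ Ioc (u - h) u}
      ≤ (Real.exp h - 1) * (expMeasure 1).real {e | w ≤ u ∧ u < w + e} := by
  have e2 : {e | w + e ∈ Ioc (u - h) u} = Ioc (u - w - h) (u - w) := by
    ext e; simp only [mem_ofPred_eq, mem_Ioc]
    constructor <;> rintro ⟨_, _⟩ <;> constructor <;> linarith
  by_cases hw : w ≤ u
  · have e1 : {e | w ≤ u ∧ u < w + e} = Ioi (u - w) := by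
      ext e; simp only [hw, true_and, mem_ofPred_eq, mem_Ioi]
      constructor <;> intro <;> linarith
    rw [e1, e2, expMeasure_real_Ioi one_pos, expMeasure_real_Ioc one_pos (by linarith),
      max_eq_right (show 0 ≤ u - w by linarith), sub_mul, ← Real.exp_add, one_mul, one_mul, one_mul]
    refine sub_le_sub_right (Real.exp_le_exp.2 ?_) _
    have := le_max_right 0 (u - w - h)
    linarith
  · rw [e2, expMeasure_real_Ioc one_pos (by linarith), max_eq_left (by linarith),
      max_eq_left (by linarith)]
    simp [hw]

instance isProbabilityMeasure_expMeasure_one : IsProbabilityMeasure (expMeasure 1) :=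
  isProbabilityMeasure_expMeasure one_pos

/-! ### Residual service times -/

/-- The event that fewer than `c` of the coordinates other than `j` are at most `u`. -/
def fewOthers {N : ℕ} (j : Fin N) (u : ℝ) (c : ℕ) : Set (Fin N → ℝ) :=
  {x | ((Finset.univ.erase j).filter fun i => x i ≤ u).card < c}

lemma measurableSet_card_filter_lt {α ι : Type*} [MeasurableSpace α] (s : Finset ι)
    {f : ι → α → ℝ} (hf : ∀ i, Measurable (f i)) (u : ℝ) (c : ℕ) :
    MeasurableSet {a | (s.filter fun i => f i a ≤ u).card < c} := by
  have h : Measurable fun a => ∑ i ∈ s, if f i a ≤ u then 1 else 0 :=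
    Finset.measurable_fun_sum _ fun i _ => Measurable.ite (measurableSet_le (hf i) measurable_const)
      measurable_const measurable_const
  have : {a | (s.filter fun i => f i a ≤ u).card < c}
      = (fun a => ∑ i ∈ s, if f i a ≤ u then 1 else 0) ⁻¹' Iio c := by
    ext a; simp only [Finset.card_filter]; rfl
  rw [this]
  exact h measurableSet_Iio

lemma measurableSet_fewOthers {N : ℕ} (j : Fin N) (u : ℝ) (c : ℕ) :
    MeasurableSet (fewOthers j u c) :=
  measurableSet_card_filter_lt _ (fun i => measurable_pi_apply i) u c

/-- Workloads and service requirements of virtual jobs. -/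
noncomputable def jobLaw {k : ℕ} (N : ℕ) (π : Measure (Fin k → ℝ)) :
    Measure ((Fin k → ℝ) × (Fin N → ℝ)) :=
  π.prod (Measure.pi fun _ : Fin N => expMeasure 1)

instance {k N : ℕ} (π : Measure (Fin k → ℝ)) [IsProbabilityMeasure π] :
    IsProbabilityMeasure (jobLaw N π) := by
  unfold jobLaw; infer_instance

/-- The completion times of virtual jobs at the queues `ι j`. -/
def virtualTimes {k N : ℕ} (ι : Fin N → Fin k) (p : (Fin k → ℝ) × (Fin N → ℝ)) : Fin N → ℝ :=
  fun j => p.1 (ι j) + p.2 j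

lemma measurable_virtualTimes {k N : ℕ} (ι : Fin N → Fin k) : Measurable (virtualTimes ι) := by
  unfold virtualTimes; fun_prop

lemma jointVirtualLaw_eq {k N : ℕ} (π : Measure (Fin k → ℝ)) (ι : Fin N → Fin k) :
    jointVirtualLaw π ι = (jobLaw N π).map (virtualTimes ι) := rfl

/-- Comparison of events that concern job `j`, jointly with the number of early completions of
other virtual jobs. -/
lemma jobLaw_mono {k N : ℕ} (π : Measure (Fin k → ℝ)) [IsProbabilityMeasure π] (ι : Fin N → Fin k)
    (j : Fin N) (u : ℝ) (c : ℕ) {J J' : ℝ → Set ℝ}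
    (hJ : MeasurableSet {p : ℝ × ℝ | p.2 ∈ J p.1}) (hJ' : MeasurableSet {p : ℝ × ℝ | p.2 ∈ J' p.1})
    {a b : ℝ} (ha : 0 ≤ a) (hb : 0 ≤ b)
    (h : ∀ w, a * (expMeasure 1).real (J w) ≤ b * (expMeasure 1).real (J' w)) :
    a * (jobLaw N π).real {p | p.2 j ∈ J (p.1 (ι j)) ∧ virtualTimes ι p ∈ fewOthers j u c}
      ≤ b * (jobLaw N π).real {p | p.2 j ∈ J' (p.1 (ι j)) ∧ virtualTimes ι p ∈ fewOthers j u c} := by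
  have hpr : Measurable fun p : (Fin k → ℝ) × (Fin N → ℝ) => (p.1 (ι j), p.2 j) := by fun_prop
  have hm : ∀ {J : ℝ → Set ℝ}, MeasurableSet {p : ℝ × ℝ | p.2 ∈ J p.1} → MeasurableSet
      {p : (Fin k → ℝ) × (Fin N → ℝ) |
        p.2 j ∈ J (p.1 (ι j)) ∧ virtualTimes ι p ∈ fewOthers j u c} := fun hJ =>
    (hpr hJ).inter (measurable_virtualTimes ι (measurableSet_fewOthers j u c))
  -- Given the workloads, the service requirements are independent, so the event of job j factors
  -- out and the factor of the other jobs is common to both sides.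
  have hsec : ∀ {J : ℝ → Set ℝ}, MeasurableSet {p : ℝ × ℝ | p.2 ∈ J p.1} → ∀ w : Fin k → ℝ,
      Measure.pi (fun _ : Fin N => expMeasure 1)
        (Prod.mk w ⁻¹' {p | p.2 j ∈ J (p.1 (ι j)) ∧ virtualTimes ι p ∈ fewOthers j u c})
      = expMeasure 1 (J (w (ι j)))
        * ∑ S ∈ (Finset.univ.erase j).powerset.filter (fun S => S.card < c),
          ∏ i ∈ Finset.univ.erase j, if i ∈ S then expMeasure 1 {e | w (ι i) + e ≤ u}
            else expMeasure 1 {e | w (ι i) + e ≤ u}ᶜ := by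
    intro J hJ w
    have hJw : MeasurableSet (J (w (ι j))) := measurable_prodMk_left (x := w (ι j)) hJ
    have h1 := pi_card_filter_lt (fun _ : Fin N => expMeasure 1) (Finset.univ.erase j)
      (A := fun i => {e | w (ι i) + e ≤ u}) (I := fun _ => J (w (ι j)))
      (fun i => measurableSet_le (by fun_prop) measurable_const) (fun _ => hJw) c
    have h2 : ((Finset.univ.erase j)ᶜ : Finset (Fin N)) = {j} := by
      ext i; simp
    rw [h2, Finset.prod_singleton] at h1
    rw [← h1]
    congr 1
    ext e
    refine and_congr (by simp) ?_
    refine Eq.to_iff (congrArg (fun n => n < c) (congrArg Finset.card (Finset.ext fun i => ?_)))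
    rw [Finset.mem_filter, Finset.mem_filter]
    rfl
  have key : ENNReal.ofReal a * jobLaw N π
        {p | p.2 j ∈ J (p.1 (ι j)) ∧ virtualTimes ι p ∈ fewOthers j u c}
      ≤ ENNReal.ofReal b * jobLaw N π
        {p | p.2 j ∈ J' (p.1 (ι j)) ∧ virtualTimes ι p ∈ fewOthers j u c} := by
    rw [jobLaw, Measure.prod_apply (hm hJ), Measure.prod_apply (hm hJ'),
      ← lintegral_const_mul' _ _ ENNReal.ofReal_ne_top,
      ← lintegral_const_mul' _ _ ENNReal.ofReal_ne_top]
    refine lintegral_mono fun w => ?_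
    simp only
    rw [hsec hJ, hsec hJ', ← mul_assoc, ← mul_assoc]
    refine mul_le_mul_left ?_ _
    have hw := ENNReal.ofReal_le_ofReal (h (w (ι j)))
    rwa [ENNReal.ofReal_mul ha, ENNReal.ofReal_mul hb, ofReal_measureReal, ofReal_measureReal] at hw
  have := ENNReal.toReal_mono (ENNReal.mul_ne_top ENNReal.ofReal_ne_top (measure_ne_top _ _)) key
  rwa [ENNReal.toReal_mul, ENNReal.toReal_mul, ENNReal.toReal_ofReal ha,
    ENNReal.toReal_ofReal hb] at this

/-- The probability that virtual job `j` is in service at time `u` while fewer than `c` of the other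
virtual jobs are completed. -/
noncomputable def inService {k N : ℕ} (π : Measure (Fin k → ℝ)) (ι : Fin N → Fin k) (j : Fin N)
    (c : ℕ) (u : ℝ) : ℝ :=
  (jobLaw N π).real {p | (p.1 (ι j) ≤ u ∧ u < p.1 (ι j) + p.2 j)
    ∧ virtualTimes ι p ∈ fewOthers j u c}

lemma jointVirtualLaw_real {k N : ℕ} (π : Measure (Fin k → ℝ)) (ι : Fin N → Fin k)
    {S : Set (Fin N → ℝ)} (hS : MeasurableSet S) :
    (jointVirtualLaw π ι).real S = (jobLaw N π).real {p | virtualTimes ι p ∈ S} := by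
  rw [jointVirtualLaw_eq, map_measureReal_apply (measurable_virtualTimes ι) hS]
  rfl

lemma measurableSet_inService (u : ℝ) :
    MeasurableSet {p : ℝ × ℝ | p.2 ∈ (fun w => {e : ℝ | w ≤ u ∧ u < w + e}) p.1} :=
  (measurableSet_le measurable_fst measurable_const).inter
    (measurableSet_lt measurable_const (measurable_fst.add measurable_snd))

lemma measurableSet_add_mem {I : Set ℝ} (hI : MeasurableSet I) :
    MeasurableSet {p : ℝ × ℝ | p.2 ∈ (fun w => {e : ℝ | w + e ∈ I}) p.1} :=
  (by fun_prop : Measurable fun p : ℝ × ℝ => p.1 + p.2) hI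

lemma measurableSet_mem_fewOthers {N : ℕ} {I : Set ℝ} (hI : MeasurableSet I) (j : Fin N) (u : ℝ)
    (c : ℕ) : MeasurableSet {x : Fin N → ℝ | x j ∈ I ∧ x ∈ fewOthers j u c} :=
  (measurable_pi_apply j hI).inter (measurableSet_fewOthers j u c)

/-- With `le_inService`, this bounds a quantity that involves the workload by the joint law of the
virtual times alone, the only law that asymptotic independence controls. -/
lemma inService_le {k N : ℕ} (π : Measure (Fin k → ℝ)) [IsProbabilityMeasure π] (ι : Fin N → Fin k)
    (j : Fin N) (c : ℕ) (u : ℝ) {h : ℝ} (hh : 0 < h) :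
    (1 - Real.exp (-h)) * inService π ι j c u
      ≤ (jointVirtualLaw π ι).real {x | x j ∈ Ioc u (u + h) ∧ x ∈ fewOthers j u c} := by
  have h1 : 0 ≤ 1 - Real.exp (-h) := by
    have := Real.exp_le_one_iff.2 (show -h ≤ 0 by linarith); linarith
  have := jobLaw_mono π ι j u c (measurableSet_inService u)
    (measurableSet_add_mem (measurableSet_Ioc (a := u) (b := u + h))) h1 zero_le_one
    (fun w => by rw [one_mul]; exact expMeasure_real_residual_le w u hh)
  rw [one_mul] at this
  rw [jointVirtualLaw_real π ι (measurableSet_mem_fewOthers measurableSet_Ioc j u c)]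
  exact this

lemma le_inService {k N : ℕ} (π : Measure (Fin k → ℝ)) [IsProbabilityMeasure π] (ι : Fin N → Fin k)
    (j : Fin N) (c : ℕ) (u : ℝ) {h : ℝ} (hh : 0 < h) :
    (jointVirtualLaw π ι).real {x | x j ∈ Ioc (u - h) u ∧ x ∈ fewOthers j u c}
      ≤ (Real.exp h - 1) * inService π ι j c u := by
  have h1 : 0 ≤ Real.exp h - 1 := by
    have := Real.add_one_le_exp h; linarith
  have := jobLaw_mono π ι j u c
    (measurableSet_add_mem (measurableSet_Ioc (a := u - h) (b := u))) (measurableSet_inService u)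
    zero_le_one h1 (fun w => by rw [one_mul]; exact le_expMeasure_real_residual w u hh)
  rw [one_mul] at this
  rw [jointVirtualLaw_real π ι (measurableSet_mem_fewOthers measurableSet_Ioc j u c)]
  exact this

/-! ### Uniform limits over selections of queues -/

/-- A number of queues and a selection of `N` distinct ones. -/
abbrev Selection (N : ℕ) : Type := Σ k : ℕ, {ι : Fin N → Fin k // Function.Injective ι}

/-- The number of queues tends to infinity, uniformly in the selection. -/
def manyQueues (N : ℕ) : Filter (Selection N) := comap Sigma.fst atTop

lemma Selection.le {N : ℕ} (p : Selection N) : N ≤ p.1 := by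
  simpa using Fintype.card_le_of_injective _ p.2.2

instance (N : ℕ) : (manyQueues N).NeBot := by
  refine comap_neBot fun s hs => ?_
  obtain ⟨K, hK⟩ := mem_atTop_sets.1 hs
  exact ⟨⟨max K N, Fin.castLE (le_max_right _ _), Fin.castLE_injective _⟩, hK _ (le_max_left _ _)⟩

lemma eventually_manyQueues {N : ℕ} {P : Selection N → Prop} :
    (∀ᶠ p in manyQueues N, P p)
      ↔ ∀ᶠ k in atTop, ∀ (ι : Fin N → Fin k) (h : Function.Injective ι), P ⟨k, ι, h⟩ := by
  rw [manyQueues, eventually_comap]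
  refine eventually_congr (Eventually.of_forall fun k => ?_)
  constructor
  · intro h ι hι
    exact h ⟨k, ι, hι⟩ rfl
  · rintro h ⟨k', ι, hι⟩ rfl
    exact h ι hι

instance {k : ℕ} (π : Measure (Fin k → ℝ)) [IsProbabilityMeasure π] (i : Fin k) :
    IsProbabilityMeasure (virtualLaw π i) :=
  Measure.isProbabilityMeasure_map (by fun_prop)

instance {k N : ℕ} (π : Measure (Fin k → ℝ)) [IsProbabilityMeasure π] (ι : Fin N → Fin k) :
    IsProbabilityMeasure (jointVirtualLaw π ι) :=
  Measure.isProbabilityMeasure_map (measurable_virtualTimes ι).aemeasurable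

/-- A probability measure as a point of the space of probability measures. -/
def toProb {α : Type*} [MeasurableSpace α] (μ : Measure α) (h : IsProbabilityMeasure μ) :
    ProbabilityMeasure α := ⟨μ, h⟩

@[simp] lemma coe_toProb {α : Type*} [MeasurableSpace α] (μ : Measure α)
    (h : IsProbabilityMeasure μ) : (toProb μ h : Measure α) = μ := rfl

lemma tendsto_virtualLaw {N : ℕ} {π : (k : ℕ) → Measure (Fin k → ℝ)} {ν : Measure ℝ}
    [IsProbabilityMeasure ν] (hπ : ∀ k, N ≤ k → IsProbabilityMeasure (π k))
    (hν : IsLimitVirtualLaw π ν) (j : Fin N) :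
    Tendsto (fun p : Selection N => have := hπ p.1 p.le
      toProb (virtualLaw (π p.1) (p.2.1 j)) inferInstance) (manyQueues N)
      (𝓝 (toProb ν inferInstance)) := by
  rw [ProbabilityMeasure.tendsto_iff_forall_integral_tendsto]
  intro f
  rw [Metric.tendsto_nhds]
  intro ε hε
  rw [eventually_manyQueues]
  filter_upwards [hν f ε hε] with k hk ι _
  exact hk (ι j)

/-- Products of probability measures are weakly continuous in their factors, so the product of the
marginals converges; asymptotic independence transfers this to the joint law. -/
lemma tendsto_jointVirtualLaw {N : ℕ} {π : (k : ℕ) → Measure (Fin k → ℝ)} {ν : Measure ℝ}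
    [IsProbabilityMeasure ν] (hπ : ∀ k, N ≤ k → IsProbabilityMeasure (π k))
    (hind : AsymptoticallyIndependent N π) (hν : IsLimitVirtualLaw π ν) :
    Tendsto (fun p : Selection N => have := hπ p.1 p.le
      toProb (jointVirtualLaw (π p.1) p.2.1) inferInstance)
      (manyQueues N) (𝓝 (toProb (Measure.pi fun _ => ν) inferInstance)) := by
  have h1 : Tendsto (fun p : Selection N => have := hπ p.1 p.le
      ProbabilityMeasure.pi fun j => toProb (virtualLaw (π p.1) (p.2.1 j)) inferInstance)
      (manyQueues N) (𝓝 (ProbabilityMeasure.pi fun _ => toProb ν inferInstance)) :=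
    (ProbabilityMeasure.continuous_pi.tendsto _).comp
      (tendsto_pi_nhds.2 fun j => tendsto_virtualLaw hπ hν j)
  rw [ProbabilityMeasure.tendsto_iff_forall_integral_tendsto] at h1 ⊢
  intro f
  have h2 : Tendsto (fun p : Selection N => ∫ x, f x ∂(jointVirtualLaw (π p.1) p.2.1)
        - ∫ x, f x ∂(Measure.pi fun j => virtualLaw (π p.1) (p.2.1 j))) (manyQueues N) (𝓝 0) := by
    rw [Metric.tendsto_nhds]
    intro ε hε
    rw [eventually_manyQueues]
    filter_upwards [hind f ε hε] with k hk ι hι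
    rw [Real.dist_eq, sub_zero]
    exact hk ι hι
  have h3 := h2.add (h1 f)
  rw [zero_add] at h3
  refine h3.congr fun p => ?_
  simp

lemma tendsto_jointVirtualLaw_real {N : ℕ} {π : (k : ℕ) → Measure (Fin k → ℝ)} {ν : Measure ℝ}
    [IsProbabilityMeasure ν] (hπ : ∀ k, N ≤ k → IsProbabilityMeasure (π k))
    (hind : AsymptoticallyIndependent N π) (hν : IsLimitVirtualLaw π ν) {S : Set (Fin N → ℝ)}
    (hS : (Measure.pi fun _ => ν) (frontier S) = 0) :
    Tendsto (fun p : Selection N => (jointVirtualLaw (π p.1) p.2.1).real S)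
      (manyQueues N) (𝓝 ((Measure.pi fun _ => ν).real S)) := by
  have h := ProbabilityMeasure.tendsto_measure_of_null_frontier_of_tendsto'
    (tendsto_jointVirtualLaw hπ hind hν) hS
  exact (ENNReal.tendsto_toReal (measure_ne_top _ _)).comp h

/-! ### Regularity of the limit law -/

lemma virtualLaw_Ioo_le {k : ℕ} (π : Measure (Fin k → ℝ)) [IsProbabilityMeasure π] (i : Fin k)
    (a b : ℝ) : virtualLaw π i (Ioo a b) ≤ ENNReal.ofReal (b - a) := by
  have hm : Measurable fun p : (Fin k → ℝ) × ℝ => p.1 i + p.2 := by fun_prop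
  rw [virtualLaw, Measure.map_apply hm measurableSet_Ioo, Measure.prod_apply (hm measurableSet_Ioo)]
  refine (lintegral_mono (g := fun _ => ENNReal.ofReal (b - a)) fun w => ?_).trans (by simp)
  rcases le_total b a with h | h
  · simp [Ioo_eq_empty (not_lt.2 h)]
  · have h1 : Prod.mk w ⁻¹' ((fun p : (Fin k → ℝ) × ℝ => p.1 i + p.2) ⁻¹' Ioo a b)
        ⊆ Ioc (a - w i) (b - w i) := by
      intro e he
      simp only [mem_preimage, mem_Ioo] at he
      constructor <;> linarith [he.1, he.2]
    refine (measure_mono h1).trans ?_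
    rw [← ofReal_measureReal]
    refine ENNReal.ofReal_le_ofReal
      ((expMeasure_real_Ioc_le (by linarith)).trans (le_of_eq (by ring)))

lemma ae_pos_expMeasure : ∀ᵐ e ∂expMeasure 1, 0 < e := by
  have h : (expMeasure 1).real (Ioi 0) = 1 := by rw [expMeasure_real_Ioi one_pos]; simp
  have h2 := (prob_compl_eq_zero_iff (measurableSet_Ioi (a := (0 : ℝ)))).2
    (show expMeasure 1 (Ioi 0) = 1 by rw [← ofReal_measureReal, h, ENNReal.ofReal_one])
  exact h2

lemma virtualLaw_Iio_zero {k : ℕ} (π : Measure (Fin k → ℝ)) [IsProbabilityMeasure π] (i : Fin k)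
    (h0 : ∀ᵐ w ∂π, ∀ q, 0 ≤ w q) : virtualLaw π i (Iio 0) = 0 := by
  have hm : Measurable fun p : (Fin k → ℝ) × ℝ => p.1 i + p.2 := by fun_prop
  rw [virtualLaw, Measure.map_apply hm measurableSet_Iio]
  have h1 : ∀ᵐ p ∂(π.prod (expMeasure 1)), ∀ q, 0 ≤ p.1 q :=
    Measure.quasiMeasurePreserving_fst.ae h0
  have h2 : ∀ᵐ p ∂(π.prod (expMeasure 1)), 0 < p.2 :=
    Measure.quasiMeasurePreserving_snd.ae ae_pos_expMeasure
  have h3 : ∀ᵐ p ∂(π.prod (expMeasure 1)), ¬ (p.1 i + p.2 < 0) := by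
    filter_upwards [h1, h2] with p hp1 hp2
    linarith [hp1 i]
  have h4 := ae_iff.1 h3
  simp only [not_not] at h4
  exact h4

/-- Portmanteau for open sets. It passes the density bound, and the absence of mass below 0, to the
limit law. -/
lemma measure_open_le_of_isLimit {N : ℕ} (hN : 1 ≤ N) {π : (k : ℕ) → Measure (Fin k → ℝ)}
    {ν : Measure ℝ} [IsProbabilityMeasure ν] (hπ : ∀ k, N ≤ k → IsProbabilityMeasure (π k))
    (hν : IsLimitVirtualLaw π ν) {G : Set ℝ} (hG : IsOpen G) {b : ℝ≥0∞}
    (hb : ∀ k, N ≤ k → ∀ i, virtualLaw (π k) i G ≤ b) : ν G ≤ b := by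
  have h := ProbabilityMeasure.le_liminf_measure_open_of_tendsto
    (tendsto_virtualLaw hπ hν ⟨0, hN⟩) hG
  refine h.trans ?_
  refine liminf_le_of_frequently_le' (Eventually.frequently (Eventually.of_forall fun p => ?_))
  exact hb _ p.le _

lemma real_Ioi_sub {ν : Measure ℝ} [IsProbabilityMeasure ν] {s t : ℝ} (hst : s ≤ t) :
    ν.real (Ioi s) - ν.real (Ioi t) = ν.real (Ioc s t) := by
  rw [← Ioi_sdiff_Ioi, measureReal_sdiff (Ioi_subset_Ioi hst) measurableSet_Ioi]

lemma nullSingletonClass_of_Ioo_le {ν : Measure ℝ} (h : ∀ a b, ν (Ioo a b) ≤ ENNReal.ofReal (b - a)) :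
    NullSingletonClass ν := by
  refine ⟨fun x => ?_⟩
  have h1 : ∀ ε : ℝ, 0 < ε → ν {x} ≤ ENNReal.ofReal (2 * ε) := fun ε hε => by
    refine (measure_mono ?_).trans ((h (x - ε) (x + ε)).trans (le_of_eq (by ring_nf)))
    rintro y rfl
    constructor <;> linarith
  have h2 : Tendsto (fun ε : ℝ => ENNReal.ofReal (2 * ε)) (𝓝[>] 0) (𝓝 0) := by
    have : Tendsto (fun ε : ℝ => ENNReal.ofReal (2 * ε)) (𝓝 0) (𝓝 (ENNReal.ofReal (2 * 0))) :=
      ((ENNReal.continuous_ofReal.comp (continuous_const.mul continuous_id)).tendsto _)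
    simp only [mul_zero, ENNReal.ofReal_zero] at this
    exact this.mono_left nhdsWithin_le_nhds
  refine le_antisymm (ge_of_tendsto h2 ?_) zero_le
  filter_upwards [self_mem_nhdsWithin] with ε hε using h1 ε hε

lemma lipschitzWith_real_Ioi {ν : Measure ℝ} [IsProbabilityMeasure ν]
    (h : ∀ a b, ν (Ioo a b) ≤ ENNReal.ofReal (b - a)) :
    LipschitzWith 1 fun t => ν.real (Ioi t) := by
  have := nullSingletonClass_of_Ioo_le h
  have key : ∀ s t, s ≤ t → |ν.real (Ioi s) - ν.real (Ioi t)| ≤ t - s := by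
    intro s t hst
    rw [real_Ioi_sub hst, abs_of_nonneg measureReal_nonneg, Measure.real,
      ← measure_congr Ioo_ae_eq_Ioc]
    exact ENNReal.toReal_le_of_le_ofReal (by linarith) (h s t)
  refine LipschitzWith.of_dist_le_mul fun s t => ?_
  rw [Real.dist_eq, Real.dist_eq, NNReal.coe_one, one_mul]
  rcases le_total s t with hst | hst
  · rw [abs_sub_comm s t, abs_of_nonneg (show 0 ≤ t - s by linarith)]; exact key s t hst
  · rw [abs_sub_comm, abs_of_nonneg (show 0 ≤ s - t by linarith)]; exact key t s hst

/-! ### Null frontiers -/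

/-- Where no coordinate equals u, the count is locally constant. -/
lemma frontier_card_filter_lt_subset {ι : Type*} [Finite ι] (s : Finset ι) (u : ℝ) (c : ℕ) :
    frontier {x : ι → ℝ | (s.filter fun i => x i ≤ u).card < c} ⊆ ⋃ i, {x | x i = u} := by
  intro x hx
  by_contra hn
  simp only [mem_iUnion, mem_ofPred_eq, not_exists] at hn
  have h1 : ∀ i, ∀ᶠ y : ι → ℝ in 𝓝 x, (y i ≤ u ↔ x i ≤ u) := by
    intro i
    have hc : Tendsto (fun y : ι → ℝ => y i) (𝓝 x) (𝓝 (x i)) := (continuous_apply i).tendsto x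
    rcases lt_or_gt_of_ne (hn i) with h | h
    · filter_upwards [hc.eventually (gt_mem_nhds h)] with y hy
      exact ⟨fun _ => h.le, fun _ => hy.le⟩
    · filter_upwards [hc.eventually (lt_mem_nhds h)] with y hy
      exact ⟨fun h' => absurd hy (not_lt.2 h'), fun h' => absurd h (not_lt.2 h')⟩
  have h2 : ∀ᶠ y : ι → ℝ in 𝓝 x,
      ((s.filter fun i => y i ≤ u).card < c ↔ (s.filter fun i => x i ≤ u).card < c) := by
    filter_upwards [eventually_all.2 h1] with y hy
    rw [Finset.filter_congr fun i _ => hy i]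
  rw [frontier_eq_closure_inter_closure] at hx
  by_cases h : (s.filter fun i => x i ≤ u).card < c
  · have h3 := mem_closure_iff_frequently.1 hx.2
    obtain ⟨y, hy1, hy2⟩ := (h3.and_eventually h2).exists
    exact hy1 (hy2.2 h)
  · have h3 := mem_closure_iff_frequently.1 hx.1
    obtain ⟨y, hy1, hy2⟩ := (h3.and_eventually h2).exists
    exact h (hy2.1 hy1)

lemma pi_eval_null {N : ℕ} (ν : Measure ℝ) [IsProbabilityMeasure ν] (i : Fin N) {A : Set ℝ}
    (hA : ν A = 0) : (Measure.pi fun _ : Fin N => ν) {x | x i ∈ A} = 0 :=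
  (Measure.quasiMeasurePreserving_eval (fun _ : Fin N => ν) i).preimage_null hA

lemma pi_frontier_card_filter_lt {N : ℕ} (ν : Measure ℝ) [IsProbabilityMeasure ν] [NullSingletonClass ν]
    (s : Finset (Fin N)) (u : ℝ) (c : ℕ) :
    (Measure.pi fun _ : Fin N => ν)
      (frontier {x : Fin N → ℝ | (s.filter fun i => x i ≤ u).card < c}) = 0 :=
  measure_mono_null (frontier_card_filter_lt_subset s u c)
    (measure_iUnion_null fun i => pi_eval_null ν i (A := {u}) (measure_singleton u))

lemma pi_frontier_mem_fewOthers {N : ℕ} (ν : Measure ℝ) [IsProbabilityMeasure ν] [NullSingletonClass ν]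
    (j : Fin N) (u : ℝ) (c : ℕ) {I : Set ℝ} (hI : ν (frontier I) = 0) :
    (Measure.pi fun _ : Fin N => ν) (frontier {x | x j ∈ I ∧ x ∈ fewOthers j u c}) = 0 := by
  refine measure_mono_null ((frontier_inter_subset ((fun x : Fin N → ℝ => x j) ⁻¹' I)
    (fewOthers j u c)).trans (union_subset_union inter_subset_left inter_subset_right)) ?_
  refine measure_union_null ?_ (pi_frontier_card_filter_lt ν _ u c)
  exact measure_mono_null (Continuous.frontier_preimage_subset (by fun_prop) I)
    (pi_eval_null ν j hI)

lemma pi_real_mem_fewOthers {N : ℕ} (ν : Measure ℝ) [IsProbabilityMeasure ν]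
    (j : Fin N) (u : ℝ) (c : ℕ) {I : Set ℝ} (hI : MeasurableSet I) :
    (Measure.pi fun _ : Fin N => ν).real {x | x j ∈ I ∧ x ∈ fewOthers j u c}
      = ν.real I * binTail (N - 1) c (ν.real (Ioi u)) := by
  have h := pi_real_card_filter_lt ν (Finset.univ.erase j) hI u c
  have h2 : ((Finset.univ.erase j)ᶜ : Finset (Fin N)) = {j} := by
    ext i; simp
  rw [h2, Finset.card_singleton, pow_one, Finset.card_erase_of_mem (Finset.mem_univ j),
    Finset.card_univ, Fintype.card_fin] at h
  rw [← h]
  congr 1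
  ext x
  simp [fewOthers]

/-! ### Limits at points of differentiability -/

lemma tendsto_div_of_hasDerivAt {f g : ℝ → ℝ} {a b : ℝ} (hf : HasDerivAt f a 0)
    (hg : HasDerivAt g b 0) (hf0 : f 0 = 0) (hg0 : g 0 = 0) (hb : b ≠ 0) :
    Tendsto (fun h => f h / g h) (𝓝[>] 0) (𝓝 (a / b)) := by
  have h1 := hf.tendsto_slope_zero_right
  have h2 := hg.tendsto_slope_zero_right
  have h3 : Tendsto (fun t => (t⁻¹ • (f (0 + t) - f 0)) / (t⁻¹ • (g (0 + t) - g 0))) (𝓝[>] 0)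
      (𝓝 (a / b)) := h1.div h2 hb
  refine h3.congr' ?_
  filter_upwards [self_mem_nhdsWithin] with h hh
  have : h ≠ 0 := ne_of_gt hh
  simp only [zero_add, hf0, hg0, sub_zero, smul_eq_mul]
  field_simp

/-- At a point where the limit tail is differentiable, the probability of being in service
converges. -/
lemma tendsto_inService {N : ℕ} {π : (k : ℕ) → Measure (Fin k → ℝ)} {ν : Measure ℝ}
    [IsProbabilityMeasure ν] [NullSingletonClass ν] (hπ : ∀ k, N ≤ k → IsProbabilityMeasure (π k))
    (hind : AsymptoticallyIndependent N π) (hν : IsLimitVirtualLaw π ν) (j : Fin N) (c : ℕ)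
    {u H' : ℝ} (hu : HasDerivAt (fun t => ν.real (Ioi t)) H' u) :
    Tendsto (fun p : Selection N => inService (π p.1) p.2.1 j c u) (manyQueues N)
      (𝓝 (-H' * binTail (N - 1) c (ν.real (Ioi u)))) := by
  set B := binTail (N - 1) c (ν.real (Ioi u)) with hB
  have hfr : ∀ a b : ℝ, ν (frontier (Ioc a b)) = 0 := fun a b => by
    rcases lt_or_ge a b with h | h
    · rw [frontier_Ioc h]; exact (toFinite _).measure_zero ν
    · simp [Ioc_eq_empty (not_lt.2 h)]
  have hJ : ∀ a b : ℝ, Tendsto (fun p : Selection N => (jointVirtualLaw (π p.1) p.2.1).real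
      {x | x j ∈ Ioc a b ∧ x ∈ fewOthers j u c}) (manyQueues N) (𝓝 (ν.real (Ioc a b) * B)) := by
    intro a b
    rw [hB, ← pi_real_mem_fewOthers ν j u c measurableSet_Ioc]
    exact tendsto_jointVirtualLaw_real hπ hind hν (pi_frontier_mem_fewOthers ν j u c (hfr a b))
  -- Both bounds of the squeeze are difference quotients of H at u, forward here and backward in
  -- `hlo`, since 1 - e^(-h) and e^h - 1 are equivalent to h.
  have hup : Tendsto (fun h => (ν.real (Ioc u (u + h)) * B) / (1 - Real.exp (-h))) (𝓝[>] 0)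
      (𝓝 (-H' * B)) := by
    have h1 : HasDerivAt (fun h : ℝ => (ν.real (Ioi u) - ν.real (Ioi (u + h))) * B) (-H' * B) 0 := by
      have : HasDerivAt (fun h : ℝ => ν.real (Ioi (u + h))) H' 0 :=
        HasDerivAt.comp_const_add u 0 (by simpa using hu)
      exact (this.const_sub _).mul_const B
    have h2 : HasDerivAt (fun h : ℝ => 1 - Real.exp (-h)) 1 0 := by
      have := ((hasDerivAt_id (0 : ℝ)).neg.exp).const_sub 1
      simpa using this
    have h3 := tendsto_div_of_hasDerivAt h1 h2 (by simp) (by simp) one_ne_zero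
    rw [div_one] at h3
    refine h3.congr' ?_
    filter_upwards [self_mem_nhdsWithin] with h hh
    rw [real_Ioi_sub (by linarith [mem_Ioi.1 hh])]
  have hlo : Tendsto (fun h => (ν.real (Ioc (u - h) u) * B) / (Real.exp h - 1)) (𝓝[>] 0)
      (𝓝 (-H' * B)) := by
    have h1 : HasDerivAt (fun h : ℝ => (ν.real (Ioi (u - h)) - ν.real (Ioi u)) * B) (-H' * B) 0 := by
      have : HasDerivAt (fun h : ℝ => ν.real (Ioi (u - h))) (-H') 0 :=
        HasDerivAt.comp_const_sub u 0 (by simpa using hu)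
      exact (this.sub_const _).mul_const B
    have h2 : HasDerivAt (fun h : ℝ => Real.exp h - 1) 1 0 := by
      simpa using (Real.hasDerivAt_exp 0).sub_const 1
    have h3 := tendsto_div_of_hasDerivAt h1 h2 (by simp) (by simp) one_ne_zero
    rw [div_one] at h3
    refine h3.congr' ?_
    filter_upwards [self_mem_nhdsWithin] with h hh
    rw [real_Ioi_sub (by linarith [mem_Ioi.1 hh])]
  -- The order of limits matters: h is fixed first, close enough to 0, and only then does the number
  -- of queues grow.
  rw [tendsto_order]
  constructor
  · intro a ha
    obtain ⟨h, hh1, hh2⟩ := ((hlo.eventually (lt_mem_nhds ha)).and self_mem_nhdsWithin).exists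
    have hpos : 0 < Real.exp h - 1 := by
      have hh2 : 0 < h := hh2
      linarith [Real.add_one_lt_exp hh2.ne']
    filter_upwards [((hJ (u - h) u).div_const (Real.exp h - 1)).eventually (lt_mem_nhds hh1)]
      with p hp
    have := hπ p.1 p.le
    refine hp.trans_le ?_
    rw [div_le_iff₀ hpos, mul_comm]
    exact le_inService _ _ _ _ _ hh2
  · intro a ha
    obtain ⟨h, hh1, hh2⟩ := ((hup.eventually (gt_mem_nhds ha)).and self_mem_nhdsWithin).exists
    have hpos : 0 < 1 - Real.exp (-h) := by
      have := Real.exp_lt_one_iff.2 (neg_lt_zero.2 hh2); linarith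
    filter_upwards [((hJ u (u + h)).div_const (1 - Real.exp (-h))).eventually (gt_mem_nhds hh1)]
      with p hp
    have := hπ p.1 p.le
    refine lt_of_le_of_lt ?_ hp
    rw [le_div_iff₀ hpos, mul_comm]
    exact inService_le _ _ _ _ _ hh2

lemma fewOthers_eq_univ {N : ℕ} (j : Fin N) (u : ℝ) : fewOthers j u N = univ := by
  refine eq_univ_of_forall fun x => ?_
  have h1 := Finset.card_filter_le (Finset.univ.erase j) (fun i => x i ≤ u)
  have h2 : (Finset.univ.erase j).card < N := by
    rw [Finset.card_erase_of_mem (Finset.mem_univ j), Finset.card_univ, Fintype.card_fin]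
    have := j.pos
    omega
  exact lt_of_le_of_lt h1 h2

/-- A virtual job not completed at u is either waiting (W > u) or in service. With c = N the
constraint on the N - 1 other jobs is void. -/
lemma workload_real_eq {k N : ℕ} (π : Measure (Fin k → ℝ)) [IsProbabilityMeasure π]
    (ι : Fin N → Fin k) (j : Fin N) (u : ℝ) :
    π.real {w | u < w (ι j)}
      = (jointVirtualLaw π ι).real {x | x j ∈ Ioi u ∧ x ∈ fewOthers j u N} - inService π ι j N u := by
  rw [jointVirtualLaw_real π ι (measurableSet_mem_fewOthers measurableSet_Ioi j u N), inService]
  simp only [fewOthers_eq_univ, mem_univ, and_true]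
  have hmW : MeasurableSet {p : (Fin k → ℝ) × (Fin N → ℝ) | u < p.1 (ι j)} :=
    measurableSet_lt measurable_const (by fun_prop)
  have h1 : π.real {w | u < w (ι j)} = (jobLaw N π).real {p | u < p.1 (ι j)} := by
    have hmw : MeasurableSet {w : Fin k → ℝ | u < w (ι j)} :=
      measurableSet_lt measurable_const (by fun_prop)
    have := (measurePreserving_fst (μ := π)
      (ν := Measure.pi fun _ : Fin N => expMeasure 1)).measureReal_preimage hmw.nullMeasurableSet
    rw [← this]; rfl
  have h2 : ∀ᵐ p ∂(jobLaw N π), 0 < p.2 j :=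
    Measure.quasiMeasurePreserving_snd.ae
      ((Measure.quasiMeasurePreserving_eval (fun _ : Fin N => expMeasure 1) j).ae ae_pos_expMeasure)
  have h3 : (jobLaw N π).real {p | u < p.1 (ι j)}
      = (jobLaw N π).real ({p | u < p.1 (ι j) + p.2 j} ∩ {p | u < p.1 (ι j)}) := by
    refine measureReal_congr ?_
    filter_upwards [h2] with p hp
    refine propext ⟨fun h => ⟨?_, h⟩, fun h => h.2⟩
    have h : u < p.1 (ι j) := h
    show u < p.1 (ι j) + p.2 j
    linarith
  have h4 := measureReal_inter_add_sdiff (μ := jobLaw N π)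
    (s := {p : (Fin k → ℝ) × (Fin N → ℝ) | u < p.1 (ι j) + p.2 j}) hmW
  have h5 : {p : (Fin k → ℝ) × (Fin N → ℝ) | p.1 (ι j) ≤ u ∧ u < p.1 (ι j) + p.2 j}
      = {p | u < p.1 (ι j) + p.2 j} \ {p | u < p.1 (ι j)} := by
    ext p
    simp [and_comm]
  have h6 : {p : (Fin k → ℝ) × (Fin N → ℝ) | virtualTimes ι p ∈ {x : Fin N → ℝ | x j ∈ Ioi u}}
      = {p | u < p.1 (ι j) + p.2 j} := rfl
  rw [h1, h3, h5, h6]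
  linarith

/-- Limit of the tail of the workloads, at points where the limit tail is differentiable. -/
lemma tendsto_workload {N : ℕ} {π : (k : ℕ) → Measure (Fin k → ℝ)} {ν : Measure ℝ}
    [IsProbabilityMeasure ν] [NullSingletonClass ν] (hπ : ∀ k, N ≤ k → IsProbabilityMeasure (π k))
    (hind : AsymptoticallyIndependent N π) (hν : IsLimitVirtualLaw π ν) (j : Fin N)
    {u H' : ℝ} (hu : HasDerivAt (fun t => ν.real (Ioi t)) H' u) :
    Tendsto (fun p : Selection N => (π p.1).real {w | u < w (p.2.1 j)}) (manyQueues N)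
      (𝓝 (ν.real (Ioi u) + H')) := by
  have hN := j.pos
  have h1 := tendsto_inService hπ hind hν j N hu
  have h2 := tendsto_jointVirtualLaw_real hπ hind hν
    (pi_frontier_mem_fewOthers ν j u N (I := Ioi u) (by rw [frontier_Ioi]; exact measure_singleton u))
  rw [pi_real_mem_fewOthers ν j u N measurableSet_Ioi] at h2
  rw [binTail_eq_one (by omega), mul_one] at h1 h2
  have h3 := h2.sub h1
  rw [sub_neg_eq_add] at h3
  refine h3.congr fun p => ?_
  have := hπ p.1 p.le
  exact (workload_real_eq _ _ _ _).symm

/-! ### Order statistics -/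

lemma lt_orderStat_iff {N n : ℕ} (hn : 1 ≤ n) (hN : n ≤ N) (x : Fin N → ℝ) (t : ℝ) :
    t < orderStat n x ↔ (Finset.univ.filter fun j => x j ≤ t).card < n := by
  set A : Set ℝ := {t : ℝ | n ≤ (Finset.univ.filter fun j => x j ≤ t).card} with hA
  have hbdd : BddBelow A := by
    obtain ⟨b, hb⟩ := (finite_range x).bddBelow
    refine ⟨b, fun s hs => ?_⟩
    have h1 : 0 < (Finset.univ.filter fun j => x j ≤ s).card := lt_of_lt_of_le hn hs
    obtain ⟨j, hj⟩ := Finset.card_pos.1 h1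
    exact (hb (mem_range_self j)).trans (Finset.mem_filter.1 hj).2
  constructor
  · intro h
    by_contra hc
    exact absurd h (not_lt.2 (csInf_le hbdd (not_lt.1 hc)))
  · intro h
    have hne : A.Nonempty := by
      obtain ⟨b, hb⟩ := (finite_range x).bddAbove
      refine ⟨b, ?_⟩
      show n ≤ (Finset.univ.filter fun j => x j ≤ b).card
      rw [Finset.filter_true_of_mem fun j _ => hb (mem_range_self j)]
      simpa using hN
    have hex : (Finset.univ.filter fun j => t < x j).Nonempty := by
      by_contra hemp
      rw [Finset.not_nonempty_iff_eq_empty, Finset.filter_eq_empty_iff] at hemp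
      rw [Finset.filter_true_of_mem fun j hj => not_lt.1 (hemp hj)] at h
      simp only [Finset.card_univ, Fintype.card_fin] at h
      omega
    -- The count does not change between t and the smallest value above t, so the infimum is at
    -- least that value; this yields a strict inequality.
    obtain ⟨j, hj, hmin⟩ := Finset.exists_min_image _ x hex
    refine lt_of_lt_of_le (Finset.mem_filter.1 hj).2 (le_csInf hne fun s hs => ?_)
    by_contra hlt
    rw [not_le] at hlt
    have h2 : (Finset.univ.filter fun i => x i ≤ s) ⊆ Finset.univ.filter fun i => x i ≤ t := by
      intro i hi
      rw [Finset.mem_filter] at hi ⊢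
      refine ⟨hi.1, ?_⟩
      by_contra hti
      have := hmin i (Finset.mem_filter.2 ⟨Finset.mem_univ i, not_le.1 hti⟩)
      linarith [hi.2]
    have hs : n ≤ (Finset.univ.filter fun i => x i ≤ s).card := hs
    have := Finset.card_le_card h2
    omega

lemma measurable_orderStat {N n : ℕ} (hn : 1 ≤ n) (hN : n ≤ N) :
    Measurable (orderStat n : (Fin N → ℝ) → ℝ) := by
  refine measurable_of_Ioi fun t => ?_
  have : orderStat n ⁻¹' Ioi t
      = {x : Fin N → ℝ | (Finset.univ.filter fun j => x j ≤ t).card < n} := by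
    ext x; exact lt_orderStat_iff hn hN x t
  rw [this]
  exact measurableSet_card_filter_lt _ (fun i => measurable_pi_apply i) t n

/-! ### Measurability of the dynamics -/

/-- The workloads found by a batch, the queues it is sent to, and its service requirements. -/
abbrev Arrival (k N : ℕ) : Type := (Fin k → ℝ) × (Fin N → Fin k) × (Fin N → ℝ)

lemma measurable_workload_apply {k N : ℕ} (j : Fin N) :
    Measurable fun p : Arrival k N => p.1 (p.2.1 j) := by
  have : (fun p : Arrival k N => p.1 (p.2.1 j))
      = fun p => ∑ q, if p.2.1 j = q then p.1 q else 0 := by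
    ext p; simp
  rw [this]
  refine Finset.measurable_fun_sum _ fun q _ => Measurable.ite ?_ (by fun_prop) measurable_const
  exact (by fun_prop : Measurable fun p : Arrival k N => p.2.1 j)
    (measurableSet_singleton q)

lemma measurable_completionTime {k N n : ℕ} (hn : 1 ≤ n) (hN : n ≤ N) :
    Measurable fun p : Arrival k N =>
      completionTime n p.1 p.2.1 p.2.2 :=
  (measurable_orderStat hn hN).comp (measurable_pi_lambda _ fun j =>
    (measurable_workload_apply j).add (by fun_prop))

lemma measurable_workloadAfter {k N n : ℕ} (hn : 1 ≤ n) (hN : n ≤ N) (q : Fin k) :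
    Measurable fun p : Arrival k N =>
      workloadAfter n p.1 p.2.1 p.2.2 q := by
  unfold workloadAfter
  simp only [Finset.sum_filter]
  refine Measurable.add (by fun_prop) (Finset.measurable_fun_sum _ fun j _ =>
    Measurable.ite ?_ ?_ measurable_const)
  · exact (by fun_prop : Measurable fun p : Arrival k N => p.2.1 j)
      (measurableSet_singleton q)
  · unfold receivedService
    refine measurable_const.max (Measurable.min (by fun_prop) ?_)
    exact (measurable_completionTime hn hN).sub (measurable_workload_apply j)

lemma measurable_nextWorkload {k N n : ℕ} (hn : 1 ≤ n) (hN : n ≤ N) :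
    Measurable fun p : Arrival k N × ℝ =>
      nextWorkload n p.1.1 p.1.2.1 p.1.2.2 p.2 := by
  refine measurable_pi_lambda _ fun q => ?_
  exact measurable_const.max
    (((measurable_workloadAfter hn hN q).comp measurable_fst).sub measurable_snd)

/-! ### The law of the arrivals -/

lemma isProbabilityMeasure_uniformOn_injective {k N : ℕ} (h : N ≤ k) :
    IsProbabilityMeasure (uniformOn {σ : Fin N → Fin k | Function.Injective σ}) :=
  isProbabilityMeasure_uniformOn (toFinite _) ⟨Fin.castLE h, Fin.castLE_injective h⟩

lemma ae_injective {k N : ℕ} :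
    ∀ᵐ σ ∂(uniformOn {σ : Fin N → Fin k | Function.Injective σ}), Function.Injective σ :=
  ae_cond_mem (toFinite _).measurableSet

lemma isProbabilityMeasure_arrivalLaw {k N : ℕ} (h : N ≤ k) (π : Measure (Fin k → ℝ))
    [IsProbabilityMeasure π] : IsProbabilityMeasure (arrivalLaw N π) := by
  have := isProbabilityMeasure_uniformOn_injective h
  unfold arrivalLaw
  infer_instance

lemma prod_real_apply {α β : Type*} [MeasurableSpace α] [MeasurableSpace β] (μ : Measure α)
    (ν : Measure β) [IsProbabilityMeasure μ] [IsProbabilityMeasure ν] {S : Set (α × β)}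
    (hS : MeasurableSet S) : (μ.prod ν).real S = ∫ x, ν.real (Prod.mk x ⁻¹' S) ∂μ := by
  rw [Measure.real, Measure.prod_apply hS, ← integral_toReal]
  · rfl
  · exact (measurable_measure_prodMk_left hS).aemeasurable
  · exact Eventually.of_forall fun x => measure_lt_top _ _

/-- Conditioning on the selection of queues. -/
lemma arrivalLaw_real {k N : ℕ} (h : N ≤ k) (π : Measure (Fin k → ℝ)) [IsProbabilityMeasure π]
    {S : Set (Arrival k N)} (hS : MeasurableSet S) :
    (arrivalLaw N π).real S
      = ∫ σ, (jobLaw N π).real {p | (p.1, σ, p.2) ∈ S}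
          ∂(uniformOn {σ : Fin N → Fin k | Function.Injective σ}) := by
  have := isProbabilityMeasure_uniformOn_injective h
  set U := uniformOn {σ : Fin N → Fin k | Function.Injective σ}
  set E := Measure.pi fun _ : Fin N => expMeasure 1
  have hmp : MeasurePreserving (fun p : (Fin N → Fin k) × (Fin k → ℝ) × (Fin N → ℝ) =>
      (p.2.1, p.1, p.2.2)) (U.prod (jobLaw N π)) (arrivalLaw N π) :=
    (measurePreserving_prodAssoc π U E).comp
      (((Measure.measurePreserving_swap (μ := U) (ν := π)).prod (MeasurePreserving.id E)).comp
        ((measurePreserving_prodAssoc U π E).symm MeasurableEquiv.prodAssoc))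
  rw [← hmp.measureReal_preimage hS.nullMeasurableSet, prod_real_apply _ _ (hmp.measurable hS)]
  rfl

/-- Convergence along `manyQueues` is uniform over selections, hence survives averaging over a
random one. -/
lemma tendsto_integral_uniformOn {N : ℕ} {g : (k : ℕ) → (Fin N → Fin k) → ℝ} {L : ℝ}
    (h : Tendsto (fun p : Selection N => g p.1 p.2.1) (manyQueues N) (𝓝 L)) :
    Tendsto (fun k => ∫ σ, g k σ ∂(uniformOn {σ : Fin N → Fin k | Function.Injective σ}))
      atTop (𝓝 L) := by
  rw [Metric.tendsto_nhds] at h ⊢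
  intro ε hε
  have h1 := h (ε / 2) (by positivity)
  rw [eventually_manyQueues] at h1
  filter_upwards [h1, eventually_ge_atTop N] with k hk hkN
  have := isProbabilityMeasure_uniformOn_injective hkN
  have h2 : ∫ σ, g k σ ∂(uniformOn {σ : Fin N → Fin k | Function.Injective σ}) - L
      = ∫ σ, (g k σ - L) ∂(uniformOn {σ : Fin N → Fin k | Function.Injective σ}) := by
    rw [integral_sub Integrable.of_finite Integrable.of_finite]
    simp
  rw [Real.dist_eq, h2]
  have h3 : ∀ᵐ σ ∂(uniformOn {σ : Fin N → Fin k | Function.Injective σ}), ‖g k σ - L‖ ≤ ε / 2 := by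
    filter_upwards [ae_injective] with σ hσ
    exact (hk σ hσ).le
  have h4 := norm_integral_le_of_norm_le_const h3
  simp only [probReal_univ, mul_one] at h4
  exact lt_of_le_of_lt h4 (by linarith)

/-! ### Stationarity -/

lemma expMeasure_real_Iio {r : ℝ} (hr : 0 < r) (y : ℝ) :
    (expMeasure r).real (Iio y) = 1 - Real.exp (-(r * max 0 y)) := by
  have := isProbabilityMeasure_expMeasure hr
  have h0 : expMeasure r {y} = 0 := by
    unfold expMeasure gammaMeasure
    exact withDensity_absolutelyContinuous _ _ (measure_singleton y)
  have h1 : (expMeasure r).real (Iic y) = (expMeasure r).real (Iio y) := by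
    refine measureReal_congr (EventuallyEq.symm ?_)
    have : ∀ᵐ x ∂expMeasure r, x ≠ y := by
      rw [ae_iff]; simpa using h0
    filter_upwards [this] with x hx
    exact propext ⟨fun h => le_of_lt h, fun h => lt_of_le_of_ne h hx⟩
  rw [← h1, ← expMeasure_real_Ioi hr, ← compl_Iic, measureReal_compl measurableSet_Iic]
  simp

/-- The probability that a workload `x` exceeds `t` after an exponential time of rate `r`. -/
noncomputable def survival (r x t : ℝ) : ℝ := 1 - Real.exp (-(r * max 0 (x - t)))

lemma measurable_survival (r : ℝ) : Measurable fun p : ℝ × ℝ => survival r p.1 p.2 := by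
  unfold survival
  exact (by fun_prop : Continuous fun p : ℝ × ℝ =>
    1 - Real.exp (-(r * max 0 (p.1 - p.2)))).measurable

lemma survival_nonneg {r : ℝ} (hr : 0 < r) (x t : ℝ) : 0 ≤ survival r x t := by
  have : Real.exp (-(r * max 0 (x - t))) ≤ 1 := Real.exp_le_one_iff.2 (by
    have := le_max_left 0 (x - t)
    nlinarith)
  unfold survival; linarith

lemma survival_le_one (r x t : ℝ) : survival r x t ≤ 1 := by
  unfold survival; linarith [Real.exp_pos (-(r * max 0 (x - t)))]

/-- Off the kink u = x, the survival function has derivative -r (1_{u < x} - survival). Integrating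
over x later turns the exponential interarrival step into the balance between W and X. -/
lemma survival_sub {r : ℝ} (x s t : ℝ) :
    survival r x s - survival r x t
      = r * ∫ u in s..t, ((Iio x).indicator (fun _ => (1 : ℝ)) u - survival r x u) := by
  have hcont : Continuous fun u => survival r x u := by unfold survival; fun_prop
  have hInt : IntervalIntegrable
      (fun u => -(r * ((Iio x).indicator (fun _ => (1 : ℝ)) u - survival r x u))) volume s t := by
    refine (IntervalIntegrable.const_mul (IntervalIntegrable.sub ?_
      (hcont.intervalIntegrable s t)) r).neg
    rw [intervalIntegrable_iff]
    exact (integrableOn_const (by simp)).indicator measurableSet_Iio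
  have h := integral_eq_of_hasDerivAt_off_countable (fun u => survival r x u)
    (fun u => -(r * ((Iio x).indicator (fun _ => (1 : ℝ)) u - survival r x u)))
    (countable_singleton x) hcont.continuousOn (a := s) (b := t) ?_ hInt
  · rw [intervalIntegral.integral_neg, intervalIntegral.integral_const_mul] at h
    linarith
  · rintro u ⟨-, hu⟩
    rcases lt_or_gt_of_ne (show u ≠ x from hu) with hlt | hgt
    · have h1 : HasDerivAt (fun u => 1 - Real.exp (-(r * (x - u)))) (-(r * Real.exp (-(r * (x - u))))) u := by
        have := ((((hasDerivAt_id u).const_sub x).const_mul r).neg.exp).const_sub 1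
        refine this.congr_deriv ?_
        simp; ring
      have h2 : (Iio x).indicator (fun _ => (1 : ℝ)) u = 1 := indicator_of_mem (mem_Iio.2 hlt) _
      have h3 : survival r x u = 1 - Real.exp (-(r * (x - u))) := by
        rw [survival, max_eq_right (by linarith)]
      rw [h2, h3, sub_sub_cancel]
      refine h1.congr_of_eventuallyEq ?_
      filter_upwards [gt_mem_nhds hlt] with v hv
      rw [survival, max_eq_right (by linarith)]
    · have h2 : (Iio x).indicator (fun _ => (1 : ℝ)) u = 0 :=
        indicator_of_notMem (fun h => absurd (mem_Iio.1 h) (not_lt.2 hgt.le)) _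
      have h3 : ∀ v, x < v → survival r x v = 0 := fun v hv => by
        rw [survival, max_eq_left (by linarith)]; simp
      rw [h2, h3 u hgt, sub_self, mul_zero, neg_zero]
      refine (hasDerivAt_const u (0 : ℝ)).congr_of_eventuallyEq ?_
      filter_upwards [lt_mem_nhds hgt] with v hv using h3 v hv

lemma IsStationary.real_workload {k n m : ℕ} {lam : ℝ} {π : Measure (Fin k → ℝ)} (hn : 1 ≤ n)
    (hlam : 0 < lam) (hk : n + m ≤ k) (h : IsStationary n m lam π) (q : Fin k) {t : ℝ}
    (ht : 0 ≤ t) :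
    π.real {w | t < w q}
      = ∫ p, survival (lam * k / n) (workloadAfter n p.1 p.2.1 p.2.2 q) t
          ∂(arrivalLaw (n + m) π) := by
  have := h.isProbabilityMeasure
  have := isProbabilityMeasure_arrivalLaw hk π
  have hk0 : (0 : ℝ) < k := by exact_mod_cast (by omega : 0 < k)
  have hn0 : (0 : ℝ) < n := by exact_mod_cast hn
  have hr : 0 < lam * k / n := by positivity
  have := isProbabilityMeasure_expMeasure hr
  have hm := measurable_nextWorkload (k := k) (N := n + m) hn (by omega)
  have hmS : MeasurableSet {w : Fin k → ℝ | t < w q} :=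
    measurableSet_lt measurable_const (by fun_prop)
  conv_lhs => rw [← h.invariant]
  rw [stepLaw, map_measureReal_apply hm hmS, prod_real_apply _ _ (hm hmS)]
  refine integral_congr_ae (Eventually.of_forall fun p => ?_)
  simp only
  rw [survival, ← expMeasure_real_Iio hr]
  congr 1
  ext a
  simp only [mem_preimage, mem_ofPred_eq, nextWorkload, lt_max_iff, mem_Iio]
  constructor
  · rintro (h' | h') <;> linarith
  · intro h'; right; linarith

/-- Level-crossing balance: `survival_sub` applied to the workload after an arrival, with
stationarity identifying the mean survival as the tail of W, and Fubini. -/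
lemma IsStationary.workload_sub {k n m : ℕ} {lam : ℝ} {π : Measure (Fin k → ℝ)} (hn : 1 ≤ n)
    (hlam : 0 < lam) (hk : n + m ≤ k) (h : IsStationary n m lam π) (q : Fin k) {s t : ℝ}
    (hs : 0 ≤ s) (hst : s ≤ t) :
    π.real {w | s < w q} - π.real {w | t < w q}
      = (lam * k / n) * ∫ u in s..t,
          ((arrivalLaw (n + m) π).real {p | u < workloadAfter n p.1 p.2.1 p.2.2 q}
            - π.real {w | u < w q}) := by
  have := h.isProbabilityMeasure
  have := isProbabilityMeasure_arrivalLaw hk π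
  have hk0 : (0 : ℝ) < k := by exact_mod_cast (by omega : 0 < k)
  have hn0 : (0 : ℝ) < n := by exact_mod_cast hn
  set r := lam * k / n with hrdef
  have hr : 0 < r := by positivity
  set A := arrivalLaw (n + m) π
  set X : Arrival k (n + m) → ℝ :=
    fun p => workloadAfter n p.1 p.2.1 p.2.2 q with hX
  have hXm : Measurable X := measurable_workloadAfter hn (by omega) q
  have hsm : ∀ u, Measurable fun p => survival r (X p) u := fun u =>
    (measurable_survival r).comp (hXm.prodMk measurable_const)
  have hsi : ∀ u, Integrable (fun p => survival r (X p) u) A := fun u =>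
    Integrable.of_bound (hsm u).aestronglyMeasurable 1 (Eventually.of_forall fun p => by
      rw [Real.norm_of_nonneg (survival_nonneg hr _ _)]; exact survival_le_one _ _ _)
  rw [h.real_workload hn hlam hk q hs, h.real_workload hn hlam hk q (hs.trans hst),
    ← integral_sub (hsi s) (hsi t)]
  have hind : ∀ u p, (Iio (X p)).indicator (fun _ => (1 : ℝ)) u
      = {p | u < X p}.indicator (fun _ => (1 : ℝ)) p := fun u p => rfl
  have hmu : ∀ u, MeasurableSet {p | u < X p} := fun u => measurableSet_lt measurable_const hXm
  have h1 : ∀ u ∈ uIcc s t, A.real {p | u < X p} - π.real {w | u < w q}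
      = ∫ p, ((Iio (X p)).indicator (fun _ => (1 : ℝ)) u - survival r (X p) u) ∂A := by
    intro u hu
    rw [uIcc_of_le hst] at hu
    rw [h.real_workload hn hlam hk q (hs.trans hu.1), integral_sub _ (hsi u)]
    · congr 1
      simp only [hind]
      rw [integral_indicator (hmu u)]
      simp
    · simp only [hind]
      exact (integrable_const 1).indicator (hmu u)
  rw [intervalIntegral.integral_congr h1]
  simp only [survival_sub _ s t]
  rw [integral_const_mul]
  congr 1
  simp only [intervalIntegral.integral_of_le hst]
  refine integral_integral_swap ?_
  refine Integrable.of_bound (Measurable.aestronglyMeasurable ?_) 2 (Eventually.of_forall fun p => ?_)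
  · refine Measurable.sub ?_ ((measurable_survival r).comp
      ((hXm.comp measurable_fst).prodMk measurable_snd))
    have : (fun p : Arrival k (n + m) × ℝ =>
        (Iio (X p.1)).indicator (fun _ => (1 : ℝ)) p.2)
        = {p : Arrival k (n + m) × ℝ |
            p.2 < X p.1}.indicator fun _ => 1 := rfl
    rw [this]
    exact measurable_const.indicator (measurableSet_lt measurable_snd (hXm.comp measurable_fst))
  · have h2 := survival_nonneg hr (X p.1) p.2
    have h3 := survival_le_one r (X p.1) p.2
    have h4 : 0 ≤ (Iio (X p.1)).indicator (fun _ => (1 : ℝ)) p.2 :=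
      indicator_nonneg (fun _ _ => zero_le_one) _
    have h5 : (Iio (X p.1)).indicator (fun _ => (1 : ℝ)) p.2 ≤ 1 :=
      indicator_le_self' (fun _ _ => zero_le_one) _
    simp only [Function.uncurry]
    rw [Real.norm_eq_abs, abs_le]
    constructor <;> linarith

/-! ### Exchange between arrivals and service -/

lemma le_workloadAfter {k N n : ℕ} (w : Fin k → ℝ) (σ : Fin N → Fin k) (e : Fin N → ℝ)
    (q : Fin k) : w q ≤ workloadAfter n w σ e q := by
  unfold workloadAfter
  exact le_add_of_nonneg_right (Finset.sum_nonneg fun j _ => le_max_left _ _)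

lemma workloadAfter_of_notMem {k N n : ℕ} (w : Fin k → ℝ) (σ : Fin N → Fin k) (e : Fin N → ℝ)
    {q : Fin k} (hq : ∀ j, σ j ≠ q) : workloadAfter n w σ e q = w q := by
  unfold workloadAfter
  rw [Finset.filter_false_of_mem fun j _ => hq j]
  simp

lemma workloadAfter_apply {k N n : ℕ} (w : Fin k → ℝ) {σ : Fin N → Fin k} (e : Fin N → ℝ)
    (hσ : Function.Injective σ) (j : Fin N) :
    workloadAfter n w σ e (σ j) = w (σ j) + receivedService n w σ e j := by
  unfold workloadAfter
  have : (Finset.univ.filter fun i => σ i = σ j) = {j} := by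
    ext i; simp [hσ.eq_iff]
  rw [this, Finset.sum_singleton]

/-- Job j occupies its server until its own completion or that of the batch. While j is unfinished
it does not count towards the n completions, so the batch condition concerns the other jobs only. -/
lemma lt_workloadAfter_iff {k N n : ℕ} (hn : 1 ≤ n) (hN : n ≤ N) (w : Fin k → ℝ)
    {σ : Fin N → Fin k} (e : Fin N → ℝ) (hσ : Function.Injective σ) (j : Fin N) (u : ℝ) :
    (w (σ j) ≤ u ∧ u < workloadAfter n w σ e (σ j))
      ↔ ((w (σ j) ≤ u ∧ u < w (σ j) + e j) ∧ virtualTimes σ (w, e) ∈ fewOthers j u n) := by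
  rw [workloadAfter_apply w e hσ, receivedService, and_assoc]
  refine and_congr_right fun hw => ?_
  have h1 : u < w (σ j) + max 0 (min (e j) (completionTime n w σ e - w (σ j)))
      ↔ u < w (σ j) + e j ∧ u < completionTime n w σ e := by
    rw [← sub_lt_iff_lt_add', lt_max_iff, lt_min_iff]
    constructor
    · rintro (h | ⟨h, h'⟩)
      · linarith
      · constructor <;> linarith
    · rintro ⟨h, h'⟩
      right; constructor <;> linarith
  rw [h1]
  refine and_congr_right fun he => ?_
  rw [completionTime, lt_orderStat_iff hn hN]
  have h2 : (Finset.univ.filter fun i => w (σ i) + e i ≤ u)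
      = (Finset.univ.erase j).filter fun i => w (σ i) + e i ≤ u := by
    ext i
    simp only [Finset.mem_filter, Finset.mem_univ, true_and, Finset.mem_erase, and_true]
    refine ⟨fun h => ⟨?_, h⟩, fun h => h.2⟩
    rintro rfl
    linarith
  rw [h2]
  rfl

/-- An arrival changes only the queues it selects, which are distinct, so the sum over queues
reindexes pointwise as a sum over jobs. Summing over all queues avoids assuming exchangeability. -/
lemma sum_workloadAfter_sub {k n m : ℕ} (hn : 1 ≤ n) (hk : n + m ≤ k) (π : Measure (Fin k → ℝ))
    [IsProbabilityMeasure π] (u : ℝ) :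
    ∑ q, ((arrivalLaw (n + m) π).real {p | u < workloadAfter n p.1 p.2.1 p.2.2 q}
        - π.real {w | u < w q})
      = ∑ j, ∫ σ, inService π σ j n u
          ∂(uniformOn {σ : Fin (n + m) → Fin k | Function.Injective σ}) := by
  have := isProbabilityMeasure_uniformOn_injective hk
  have := isProbabilityMeasure_arrivalLaw hk π
  set A := arrivalLaw (n + m) π with hA
  let SB : Fin k → Set (Arrival k (n + m)) := fun q => {p | p.1 q ≤ u ∧ u < workloadAfter n p.1 p.2.1 p.2.2 q}
  let SJ : Fin (n + m) → Set (Arrival k (n + m)) := fun j => {p |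
    (p.1 (p.2.1 j) ≤ u ∧ u < p.1 (p.2.1 j) + p.2.2 j)
      ∧ virtualTimes p.2.1 (p.1, p.2.2) ∈ fewOthers j u n}
  have hmX : ∀ q, MeasurableSet {p : Arrival k (n + m) | u < workloadAfter n p.1 p.2.1 p.2.2 q} := fun q =>
    measurableSet_lt measurable_const (measurable_workloadAfter hn (by omega) q)
  have hmW : ∀ q, MeasurableSet {p : Arrival k (n + m) | u < p.1 q} := fun q =>
    measurableSet_lt measurable_const (by fun_prop)
  have hmSB : ∀ q, MeasurableSet (SB q) := fun q =>
    (measurableSet_le ((measurable_pi_apply q).comp measurable_fst) measurable_const).inter (hmX q)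
  have hmV : Measurable fun p : Arrival k (n + m) => virtualTimes p.2.1 (p.1, p.2.2) :=
    measurable_pi_lambda _ fun j => (measurable_workload_apply j).add (by fun_prop)
  have hmSJ : ∀ j, MeasurableSet (SJ j) := fun j =>
    ((measurableSet_le (measurable_workload_apply j) measurable_const).inter
      (measurableSet_lt measurable_const ((measurable_workload_apply j).add (by fun_prop)))).inter
      (hmV (measurableSet_fewOthers j u n))
  have h1 : ∀ q, A.real {p | u < workloadAfter n p.1 p.2.1 p.2.2 q} - π.real {w | u < w q}
      = A.real (SB q) := by
    intro q
    have hmw : MeasurableSet {w : Fin k → ℝ | u < w q} :=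
      measurableSet_lt measurable_const (by fun_prop)
    have e1 : π.real {w | u < w q} = A.real {p | u < p.1 q} := by
      rw [hA, arrivalLaw, ← (measurePreserving_fst (μ := π)
        (ν := (uniformOn {σ : Fin (n + m) → Fin k | Function.Injective σ}).prod
          (Measure.pi fun _ : Fin (n + m) => expMeasure 1))).measureReal_preimage
        hmw.nullMeasurableSet]
      rfl
    have hsub : {p : Arrival k (n + m) | u < p.1 q} ⊆ {p : Arrival k (n + m) | u < workloadAfter n p.1 p.2.1 p.2.2 q} :=
      fun p hp => lt_of_lt_of_le hp (le_workloadAfter _ _ _ _)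
    rw [e1, ← measureReal_sdiff hsub (hmW q)]
    congr 1
    ext p
    simp only [SB, Set.mem_sdiff, mem_ofPred_eq, not_lt]
    exact and_comm
  have h2 : ∀ j, ∫ σ, inService π σ j n u
      ∂(uniformOn {σ : Fin (n + m) → Fin k | Function.Injective σ}) = A.real (SJ j) := fun j => by
    rw [hA, arrivalLaw_real hk π (hmSJ j)]
    rfl
  have hAe : ∀ᵐ p ∂A, Function.Injective p.2.1 := by
    have e1 : ∀ᵐ p ∂((uniformOn {σ : Fin (n + m) → Fin k | Function.Injective σ}).prod
        (Measure.pi fun _ : Fin (n + m) => expMeasure 1)), Function.Injective p.1 :=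
      Measure.quasiMeasurePreserving_fst.ae ae_injective
    exact Measure.quasiMeasurePreserving_snd.ae e1
  have hpt : ∀ᵐ p ∂A, ∑ q, (SB q).indicator (fun _ => (1 : ℝ)) p
      = ∑ j, (SJ j).indicator (fun _ => (1 : ℝ)) p := by
    filter_upwards [hAe] with p hp
    have e1 : ∀ j, (SJ j).indicator (fun _ => (1 : ℝ)) p
        = (SB (p.2.1 j)).indicator (fun _ => (1 : ℝ)) p := by
      intro j
      have : p ∈ SJ j ↔ p ∈ SB (p.2.1 j) :=
        (lt_workloadAfter_iff hn (by omega) p.1 p.2.2 hp j u).symm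
      by_cases hj : p ∈ SJ j
      · rw [indicator_of_mem hj, indicator_of_mem (this.1 hj)]
      · rw [indicator_of_notMem hj, indicator_of_notMem fun h => hj (this.2 h)]
    simp only [e1]
    rw [← Finset.sum_image (s := Finset.univ) (g := p.2.1)
      (f := fun q => (SB q).indicator (fun _ => (1 : ℝ)) p) (fun _ _ _ _ h => hp h)]
    symm
    refine Finset.sum_subset (Finset.subset_univ _) fun q _ hq => indicator_of_notMem ?_ _
    rintro ⟨ha, hb⟩
    rw [workloadAfter_of_notMem] at hb
    · exact absurd hb (not_lt.2 ha)
    · intro j hj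
      exact hq (Finset.mem_image.2 ⟨j, Finset.mem_univ j, hj⟩)
  have hInt : ∀ S : Set (Arrival k (n + m)), MeasurableSet S → Integrable (S.indicator fun _ => (1 : ℝ)) A :=
    fun S hS => (integrable_const 1).indicator hS
  have hreal : ∀ S : Set (Arrival k (n + m)), MeasurableSet S → A.real S = ∫ p, S.indicator (fun _ => (1 : ℝ)) p ∂A :=
    fun S hS => by rw [integral_indicator hS]; simp
  simp only [h1, h2]
  rw [Finset.sum_congr rfl fun q _ => hreal _ (hmSB q),
    Finset.sum_congr rfl fun j _ => hreal _ (hmSJ j),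
    ← integral_finsetSum _ fun q _ => hInt _ (hmSB q),
    ← integral_finsetSum _ fun j _ => hInt _ (hmSJ j)]
  exact integral_congr_ae hpt

lemma completionLaw_real_Ioi {k n m : ℕ} (hn : 1 ≤ n) (hk : n + m ≤ k) (π : Measure (Fin k → ℝ))
    [IsProbabilityMeasure π] (t : ℝ) :
    (completionLaw n m π).real (Ioi t)
      = ∫ σ, (jointVirtualLaw π σ).real {x | (Finset.univ.filter fun j => x j ≤ t).card < n}
          ∂(uniformOn {σ : Fin (n + m) → Fin k | Function.Injective σ}) := by
  have hm := measurable_completionTime (k := k) (N := n + m) hn (by omega)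
  rw [completionLaw, map_measureReal_apply hm measurableSet_Ioi,
    arrivalLaw_real hk π (hm measurableSet_Ioi)]
  congr 1
  ext σ
  rw [jointVirtualLaw_real π σ (measurableSet_card_filter_lt _ (fun i => measurable_pi_apply i) t n)]
  congr 1
  ext p
  exact lt_orderStat_iff hn (by omega) _ t

/-! ### Passage to the limit in the balance equation -/

lemma inService_nonneg {k N : ℕ} (π : Measure (Fin k → ℝ)) (ι : Fin N → Fin k) (j : Fin N)
    (c : ℕ) (u : ℝ) : 0 ≤ inService π ι j c u := measureReal_nonneg

lemma inService_le_one {k N : ℕ} (π : Measure (Fin k → ℝ)) [IsProbabilityMeasure π]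
    (ι : Fin N → Fin k) (j : Fin N) (c : ℕ) (u : ℝ) : inService π ι j c u ≤ 1 := measureReal_le_one

lemma tendsto_average_workload {N : ℕ} (hN : 1 ≤ N) {π : (k : ℕ) → Measure (Fin k → ℝ)}
    {ν : Measure ℝ} [IsProbabilityMeasure ν] [NullSingletonClass ν]
    (hπ : ∀ k, N ≤ k → IsProbabilityMeasure (π k))
    (hind : AsymptoticallyIndependent N π) (hν : IsLimitVirtualLaw π ν)
    {u H' : ℝ} (hu : HasDerivAt (fun t => ν.real (Ioi t)) H' u) :
    Tendsto (fun k : ℕ => (∑ q, (π k).real {w | u < w q}) / k) atTop (𝓝 (ν.real (Ioi u) + H')) := by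
  have h := tendsto_workload hπ hind hν ⟨0, hN⟩ hu
  set L := ν.real (Ioi u) + H'
  rw [Metric.tendsto_nhds] at h ⊢
  intro ε hε
  have h1 := h (ε / 2) (by positivity)
  rw [eventually_manyQueues] at h1
  filter_upwards [h1, eventually_ge_atTop N] with k hk hkN
  have hk0 : (0 : ℝ) < k := by exact_mod_cast (by omega : 0 < k)
  have h2 : ∀ q : Fin k, |(π k).real {w | u < w q} - L| ≤ ε / 2 := by
    intro q
    -- A transposition produces an injective selection whose first queue is q, so the uniform limit
    -- reaches every queue.
    have := hk (Equiv.swap (Fin.castLE hkN ⟨0, hN⟩) q ∘ Fin.castLE hkN)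
      ((Equiv.injective _).comp (Fin.castLE_injective hkN))
    simp only [Function.comp, Equiv.swap_apply_left] at this
    exact this.le
  have h3 : (∑ q, (π k).real {w | u < w q}) / k - L
      = (∑ q, ((π k).real {w | u < w q} - L)) / k := by
    rw [Finset.sum_sub_distrib]
    simp
    field_simp
  rw [Real.dist_eq, h3, abs_div, abs_of_pos hk0, div_lt_iff₀ hk0]
  calc |∑ q, ((π k).real {w | u < w q} - L)| ≤ ∑ q : Fin k, |(π k).real {w | u < w q} - L| :=
        Finset.abs_sum_le_sum_abs _ _
    _ ≤ ∑ q : Fin k, ε / 2 := Finset.sum_le_sum fun q _ => h2 q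
    _ = k * (ε / 2) := by simp
    _ < ε * k := by nlinarith

lemma antitone_real_lt {α : Type*} [MeasurableSpace α] (μ : Measure α) [IsFiniteMeasure μ]
    (f : α → ℝ) : Antitone fun u => μ.real {a | u < f a} := fun _ _ huv =>
  measureReal_mono fun _ ha => lt_of_le_of_lt huv ha

/-- The factor k in the arrival rate cancels the 1/k of the average, which leaves a balance with a
nontrivial limit. -/
lemma IsStationary.average_workload_sub {k n m : ℕ} {lam : ℝ} {π : Measure (Fin k → ℝ)}
    (hn : 1 ≤ n) (hlam : 0 < lam) (hk : n + m ≤ k) (h : IsStationary n m lam π) {s t : ℝ}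
    (hs : 0 ≤ s) (hst : s ≤ t) :
    (∑ q, π.real {w | s < w q}) / k - (∑ q, π.real {w | t < w q}) / k
      = (lam / n) * ∫ u in s..t, ∑ q,
        ((arrivalLaw (n + m) π).real {p | u < workloadAfter n p.1 p.2.1 p.2.2 q}
            - π.real {w | u < w q}) := by
  have := h.isProbabilityMeasure
  have := isProbabilityMeasure_arrivalLaw hk π
  have hk0 : (0 : ℝ) < k := by exact_mod_cast (by omega : 0 < k)
  rw [intervalIntegral.integral_finsetSum fun q _ =>
      ((antitone_real_lt _ _).intervalIntegrable).sub ((antitone_real_lt _ _).intervalIntegrable),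
    ← sub_div, ← Finset.sum_sub_distrib,
    Finset.sum_congr rfl fun q _ => h.workload_sub hn hlam hk q hs hst, ← Finset.mul_sum]
  field_simp

/-- The averaged balance in the limit, by dominated convergence: the integrand is a sum of n + m
probabilities and converges at almost every u. -/
lemma integrated_balance {n m : ℕ} (hn : 1 ≤ n) {lam : ℝ} (hlam : 0 < lam)
    {π : (k : ℕ) → Measure (Fin k → ℝ)} (hstat : ∀ k, n + m ≤ k → IsStationary n m lam (π k))
    (hind : AsymptoticallyIndependent (n + m) π) {ν : Measure ℝ} [IsProbabilityMeasure ν]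
    [NullSingletonClass ν] (hν : IsLimitVirtualLaw π ν)
    (hdiff : ∀ᵐ u, DifferentiableAt ℝ (fun t => ν.real (Ioi t)) u) {s t : ℝ}
    (hs : 0 ≤ s) (hst : s ≤ t) (hds : DifferentiableAt ℝ (fun t => ν.real (Ioi t)) s)
    (hdt : DifferentiableAt ℝ (fun t => ν.real (Ioi t)) t) :
    (ν.real (Ioi s) + deriv (fun t => ν.real (Ioi t)) s)
        - (ν.real (Ioi t) + deriv (fun t => ν.real (Ioi t)) t)
      = (lam * ((m : ℝ) + n) / n) * ∫ u in s..t,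
          -deriv (fun t => ν.real (Ioi t)) u * binTail (n + m - 1) n (ν.real (Ioi u)) := by
  have hπ : ∀ k, n + m ≤ k → IsProbabilityMeasure (π k) := fun k hk =>
    (hstat k hk).isProbabilityMeasure
  have hL := (tendsto_average_workload (by omega) hπ hind hν hds.hasDerivAt).sub
    (tendsto_average_workload (by omega) hπ hind hν hdt.hasDerivAt)
  have hI : ∀ᵐ u, Tendsto (fun k => ∑ j, ∫ σ, inService (π k) σ j n u
      ∂(uniformOn {σ : Fin (n + m) → Fin k | Function.Injective σ})) atTop
      (𝓝 (((m : ℝ) + n) * (-deriv (fun t => ν.real (Ioi t)) u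
        * binTail (n + m - 1) n (ν.real (Ioi u))))) := by
    filter_upwards [hdiff] with u hu
    have h1 := tendsto_finsetSum (Finset.univ : Finset (Fin (n + m))) fun j _ =>
      tendsto_integral_uniformOn (g := fun k σ => inService (π k) σ j n u)
        (tendsto_inService hπ hind hν j n hu.hasDerivAt)
    convert h1 using 2
    simp [add_comm]
  have hD : Tendsto (fun k => ∫ u in s..t, ∑ j, ∫ σ, inService (π k) σ j n u
      ∂(uniformOn {σ : Fin (n + m) → Fin k | Function.Injective σ})) atTop
      (𝓝 (∫ u in s..t, (((m : ℝ) + n) * (-deriv (fun t => ν.real (Ioi t)) u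
        * binTail (n + m - 1) n (ν.real (Ioi u)))))) := by
    refine intervalIntegral.tendsto_integral_filter_of_dominated_convergence
      (fun _ => ((n + m : ℕ) : ℝ)) ?_ ?_ (by simp) ?_
    · filter_upwards [eventually_ge_atTop (n + m)] with k hk
      have := hπ k hk
      have := isProbabilityMeasure_arrivalLaw hk (π k)
      -- Measurability in u is read off the other side of the identity, a sum of differences of
      -- monotone functions.
      simp only [← sum_workloadAfter_sub hn hk (π k)]
      exact (Finset.measurable_fun_sum _ fun q _ => ((antitone_real_lt _ _).measurable).sub
        ((antitone_real_lt _ _).measurable)).aestronglyMeasurable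
    · filter_upwards [eventually_ge_atTop (n + m)] with k hk
      have := hπ k hk
      have := isProbabilityMeasure_uniformOn_injective hk
      refine Eventually.of_forall fun u _ => ?_
      refine (norm_sum_le _ _).trans ?_
      have h1 : ∀ j : Fin (n + m), ‖∫ σ, inService (π k) σ j n u
          ∂(uniformOn {σ : Fin (n + m) → Fin k | Function.Injective σ})‖ ≤ 1 := fun j => by
        have := norm_integral_le_of_norm_le_const
          (μ := uniformOn {σ : Fin (n + m) → Fin k | Function.Injective σ})
          (f := fun σ => inService (π k) σ j n u) (C := 1)
          (Eventually.of_forall fun σ => by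
            rw [Real.norm_of_nonneg (inService_nonneg _ _ _ _ _)]
            exact inService_le_one _ _ _ _ _)
        simpa using this
      refine (Finset.sum_le_sum fun j _ => h1 j).trans ?_
      simp
    · filter_upwards [hI] with u hu _ using hu
  have hR := hD.const_mul (lam / n)
  have heq := tendsto_nhds_unique hL (hR.congr' ?_)
  · rw [heq, intervalIntegral.integral_const_mul]
    ring
  · filter_upwards [eventually_ge_atTop (n + m)] with k hk
    have := hπ k hk
    simp only [← sum_workloadAfter_sub hn hk (π k)]
    exact ((hstat k hk).average_workload_sub hn hlam hk hs hst).symm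

lemma intTail_lipschitz {n m : ℕ} (hn : 1 ≤ n) (hm : 1 ≤ m) :
    LipschitzOnWith 1 (intTail n m) (Icc 0 1) := by
  refine (convex_Icc (0 : ℝ) 1).lipschitzOnWith_of_nnnorm_hasDerivWithin_le
    (fun x _ => (hasDerivAt_intTail hn hm x).hasDerivWithinAt) fun x hx => ?_
  rw [← NNReal.coe_le_coe, coe_nnnorm, Real.norm_of_nonneg (binTail_nonneg _ _ hx.1 hx.2)]
  exact binTail_le_one _ _ hx.1 hx.2

lemma tendsto_real_Ioi_atTop (ν : Measure ℝ) [IsProbabilityMeasure ν] :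
    Tendsto (fun t => ν.real (Ioi t)) atTop (𝓝 0) := by
  have h := (tendsto_cdf_atTop ν).const_sub 1
  rw [sub_self] at h
  refine h.congr fun t => ?_
  rw [cdf_eq_real, ← compl_Iic, measureReal_compl measurableSet_Iic]
  simp

/-- The differential equation for the limit tail, almost everywhere. -/
lemma ae_deriv_eq {n m : ℕ} (hn : 1 ≤ n) (hm : 1 ≤ m) {lam : ℝ} (hlam : 0 < lam)
    {π : (k : ℕ) → Measure (Fin k → ℝ)} (hstat : ∀ k, n + m ≤ k → IsStationary n m lam (π k))
    (hind : AsymptoticallyIndependent (n + m) π) {ν : Measure ℝ} [IsProbabilityMeasure ν]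
    (hIoo : ∀ a b, ν (Ioo a b) ≤ ENNReal.ofReal (b - a)) (hν : IsLimitVirtualLaw π ν) :
    ∀ᵐ s, 0 ≤ s → deriv (fun t => ν.real (Ioi t)) s
      = -ν.real (Ioi s) + lam * ((m : ℝ) + n) / n * intTail n m (ν.real (Ioi s)) := by
  have := nullSingletonClass_of_Ioo_le hIoo
  set H : ℝ → ℝ := fun t => ν.real (Ioi t) with hH
  set α : ℝ := lam * ((m : ℝ) + n) / n with hα
  have hlip : LipschitzWith 1 H := lipschitzWith_real_Ioi hIoo
  have hdiff : ∀ᵐ u, DifferentiableAt ℝ H u := hlip.ae_differentiableAt_real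
  have hmem : ∀ t, H t ∈ Icc (0 : ℝ) 1 := fun t => ⟨measureReal_nonneg, measureReal_le_one⟩
  have hlipΦ : LipschitzWith 1 (fun t => intTail n m (H t)) := by
    refine LipschitzWith.of_dist_le_mul fun s t => ?_
    refine ((intTail_lipschitz hn hm).dist_le_mul _ (hmem s) _ (hmem t)).trans ?_
    simpa using hlip.dist_le_mul s t
  have hInt : ∀ s t, ∫ u in s..t, -deriv H u * binTail (n + m - 1) n (H u)
      = intTail n m (H s) - intTail n m (H t) := by
    intro s t
    -- The fundamental theorem of calculus with only almost everywhere differentiability: a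
    -- Lipschitz function is absolutely continuous.
    have h1 := ((hlipΦ.lipschitzOnWith (s := uIcc s t)).absolutelyContinuousOnInterval).integral_deriv_eq_sub
    have h2 : ∫ u in s..t, -deriv H u * binTail (n + m - 1) n (H u)
        = ∫ u in s..t, -deriv (fun t => intTail n m (H t)) u := by
      refine intervalIntegral.integral_congr_ae ?_
      filter_upwards [hdiff] with u hu _
      have h3 : HasDerivAt (fun t => intTail n m (H t)) (binTail (n + m - 1) n (H u) * deriv H u) u :=
        (hasDerivAt_intTail hn hm (H u)).comp u hu.hasDerivAt
      rw [h3.deriv]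
      ring
    rw [h2, intervalIntegral.integral_neg, h1]
    ring
  have hkey : ∀ s t, 0 ≤ s → s ≤ t → DifferentiableAt ℝ H s → DifferentiableAt ℝ H t →
      (H s + deriv H s) - (H t + deriv H t) = α * (intTail n m (H s) - intTail n m (H t)) := by
    intro s t hs hst hds hdt
    rw [← hInt s t]
    exact integrated_balance hn hlam hstat hind hν hdiff hs hst hds hdt
  have hπ : ∀ k, n + m ≤ k → IsProbabilityMeasure (π k) := fun k hk =>
    (hstat k hk).isProbabilityMeasure
  -- H + H' is a limit of workload tails, hence nonnegative, and H' ≤ 0. This controls H' at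
  -- infinity.
  have hbound : ∀ t, DifferentiableAt ℝ H t → |H t + deriv H t| ≤ H t := by
    intro t hdt
    have h1 : 0 ≤ H t + deriv H t :=
      ge_of_tendsto' (tendsto_workload hπ hind hν ⟨0, by omega⟩ hdt.hasDerivAt)
        fun _ => measureReal_nonneg
    have h2 : deriv H t ≤ 0 := Antitone.deriv_nonpos
      (fun a b hab => measureReal_mono (Ioi_subset_Ioi hab))
    rw [abs_of_nonneg h1]
    linarith
  have hlim : Tendsto H atTop (𝓝 0) := tendsto_real_Ioi_atTop ν
  have hlim2 : Tendsto (fun t => H t + |α * intTail n m (H t)|) atTop (𝓝 0) := by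
    have h1 : Tendsto (fun t => H t + |α * intTail n m (H t)|) atTop
        (𝓝 (0 + |α * intTail n m 0|)) :=
      hlim.add ((((continuous_intTail n m).tendsto 0).comp hlim).const_mul α).abs
    simpa [intTail_zero] using h1
  filter_upwards [hdiff] with s hds hs
  -- The constant of integration is evaluated at points of differentiability arbitrarily far out,
  -- where it is below any ε.
  have hzero : |H s + deriv H s - α * intTail n m (H s)| ≤ 0 := by
    refine le_of_forall_pos_le_add fun ε hε => ?_
    obtain ⟨T, hT⟩ := eventually_atTop.1 (hlim2.eventually (gt_mem_nhds hε))
    have hfreq : ∃ t, max s T ≤ t ∧ DifferentiableAt ℝ H t := by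
      by_contra hcon
      push Not at hcon
      have h1 : Ici (max s T) ⊆ {u | ¬ DifferentiableAt ℝ H u} := fun t ht => hcon t ht
      have h2 := measure_mono_null h1 (ae_iff.1 hdiff)
      simp at h2
    obtain ⟨t, ht, hdt⟩ := hfreq
    have h1 := hkey s t hs ((le_max_left _ _).trans ht) hds hdt
    have h2 : H s + deriv H s - α * intTail n m (H s)
        = (H t + deriv H t) - α * intTail n m (H t) := by linarith
    rw [h2, zero_add]
    have h3 := hT t ((le_max_right _ _).trans ht)
    have h4 := abs_sub (H t + deriv H t) (α * intTail n m (H t))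
    have h5 := hbound t hdt
    linarith
  have := abs_nonpos_iff.1 hzero
  linarith

/-- The differential equation for the limit tail. -/
lemma hasDerivWithinAt_tail {n m : ℕ} (hn : 1 ≤ n) (hm : 1 ≤ m) {lam : ℝ} (hlam : 0 < lam)
    {π : (k : ℕ) → Measure (Fin k → ℝ)} (hstat : ∀ k, n + m ≤ k → IsStationary n m lam (π k))
    (hind : AsymptoticallyIndependent (n + m) π) {ν : Measure ℝ} [IsProbabilityMeasure ν]
    (hIoo : ∀ a b, ν (Ioo a b) ≤ ENNReal.ofReal (b - a)) (hν : IsLimitVirtualLaw π ν)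
    {t : ℝ} (ht : 0 ≤ t) :
    HasDerivWithinAt (fun t => ν.real (Ioi t))
      (-ν.real (Ioi t) + lam * ((m : ℝ) + n) / n * intTail n m (ν.real (Ioi t))) (Ici 0) t := by
  set H : ℝ → ℝ := fun t => ν.real (Ioi t) with hH
  set α : ℝ := lam * ((m : ℝ) + n) / n with hα
  have hae := ae_deriv_eq hn hm hlam hstat hind hIoo hν
  have hlip : LipschitzWith 1 H := lipschitzWith_real_Ioi hIoo
  have hcont : Continuous fun u => -H u + α * intTail n m (H u) :=
    hlip.continuous.neg.add (continuous_const.mul ((continuous_intTail n m).comp hlip.continuous))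
  -- H is absolutely continuous, so the almost everywhere equation integrates; the integrand is
  -- continuous, so differentiating back gives the equation at every point.
  have hrep : ∀ t, 0 ≤ t → H t = H 0 + ∫ u in (0 : ℝ)..t, (-H u + α * intTail n m (H u)) := by
    intro t ht
    have h1 := ((hlip.lipschitzOnWith (s := uIcc 0 t)).absolutelyContinuousOnInterval).integral_deriv_eq_sub
    have h2 : ∫ u in (0 : ℝ)..t, deriv H u = ∫ u in (0 : ℝ)..t, (-H u + α * intTail n m (H u)) := by
      refine intervalIntegral.integral_congr_ae ?_
      filter_upwards [hae] with u hu hut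
      rw [uIoc_of_le ht] at hut
      exact hu hut.1.le
    rw [← h2, h1]
    ring
  have hK : HasDerivAt (fun t => H 0 + ∫ u in (0 : ℝ)..t, (-H u + α * intTail n m (H u)))
      (-H t + α * intTail n m (H t)) t :=
    (hcont.integral_hasStrictDerivAt 0 t).hasDerivAt.const_add _
  exact hK.hasDerivWithinAt.congr (fun u hu => hrep u hu) (hrep t ht)

lemma real_Ioi_zero {n m : ℕ} (hn : 1 ≤ n) {lam : ℝ}
    {π : (k : ℕ) → Measure (Fin k → ℝ)} (hstat : ∀ k, n + m ≤ k → IsStationary n m lam (π k))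
    {ν : Measure ℝ} [IsProbabilityMeasure ν] [NullSingletonClass ν] (hν : IsLimitVirtualLaw π ν) :
    ν.real (Ioi 0) = 1 := by
  have h0 : ν (Iio 0) = 0 := by
    refine le_antisymm (measure_open_le_of_isLimit (N := n + m) (by omega)
      (fun k hk => (hstat k hk).isProbabilityMeasure) hν isOpen_Iio fun k hk i => ?_) zero_le
    have := (hstat k hk).isProbabilityMeasure
    exact (virtualLaw_Iio_zero (π k) i (hstat k hk).nonneg).le
  have h1 : ν (Iic 0) = 0 := by rw [← measure_congr Iio_ae_eq_Iic, h0]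
  rw [← compl_Iic, measureReal_compl measurableSet_Iic, probReal_univ, Measure.real, h1]
  simp

/-- A limit law exists only below the critical load. -/
lemma lam_lt_one {n m : ℕ} (hn : 1 ≤ n) (hm : 1 ≤ m) {lam : ℝ} {H : ℝ → ℝ} (hlam : 0 < lam)
    (hH0 : ∀ t, 0 ≤ H t) (hH1 : ∀ t, H t ≤ 1) (hlim : Tendsto H atTop (𝓝 0)) (hzero : H 0 = 1)
    (hode : ∀ t, 0 ≤ t → HasDerivWithinAt H
      (-H t + lam * ((m : ℝ) + n) / n * intTail n m (H t)) (Ici 0) t) : lam < 1 := by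
  by_contra hge
  rw [not_lt] at hge
  have hn0 : (0 : ℝ) < n := by exact_mod_cast hn
  set α : ℝ := lam * ((m : ℝ) + n) / n with hα
  have hα0 : 0 ≤ α := by positivity
  -- Thus the drift of H at the value 1 is λ - 1, nonnegative in the supposed case; the Lipschitz
  -- bound on `intTail` gives the lower bound -α(1 - x) below 1.
  have hα1 : α * intTail n m 1 = lam := by
    rw [intTail_one hn hm, hα]
    have : (n : ℝ) + m ≠ 0 := by positivity
    field_simp
    ring
  have h1 : ∀ t, 0 ≤ t → H t = 1 := fun t ht => by
    refine eq_one_of_ode (g := fun x => -x + α * intTail n m x) (α := α) ?_ hH0 hH1 hzero hode ht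
    intro x hx0 hx1
    have h2 := (intTail_lipschitz hn hm).dist_le_mul 1 ⟨zero_le_one, le_rfl⟩ x ⟨hx0, hx1⟩
    rw [Real.dist_eq, Real.dist_eq, NNReal.coe_one, one_mul,
      abs_of_nonneg (show 0 ≤ 1 - x by linarith)] at h2
    have h3 := mul_le_mul_of_nonneg_left ((le_abs_self _).trans h2) hα0
    nlinarith
  have h2 : Tendsto H atTop (𝓝 1) :=
    tendsto_const_nhds.congr' (by
      filter_upwards [eventually_ge_atTop 0] with t ht using (h1 t ht).symm)
  exact zero_ne_one (tendsto_nhds_unique hlim h2)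

/-! ### Tails of the completion times -/

/-- With x = e^(t(d-1)) ≥ 1, the denominator is at most x, and (1/x)^(d/(d-1)) = e^(-dt). Finally 1
- (1 - y)^n ≥ y for y in [0, 1]. -/
lemma exp_le_replicationTail {lam : ℝ} (h0 : 0 < lam) (h1 : lam < 1) {n d : ℕ} (hn : 1 ≤ n)
    (hd : 2 ≤ d) {t : ℝ} (ht : 0 ≤ t) : Real.exp (-(d * t)) ≤ replicationTail lam n d t := by
  have hd1 : (0 : ℝ) < (d : ℝ) - 1 := by
    have : (2 : ℝ) ≤ d := by exact_mod_cast hd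
    linarith
  unfold replicationTail
  set x := Real.exp (t * ((d : ℝ) - 1)) with hx
  have hx1 : 1 ≤ x := Real.one_le_exp (by positivity)
  have hD1 : 1 ≤ lam + (1 - lam) * x := by nlinarith
  have hDx : lam + (1 - lam) * x ≤ x := by nlinarith
  have hp : 0 ≤ (d : ℝ) / ((d : ℝ) - 1) := by positivity
  set y := (1 / (lam + (1 - lam) * x)) ^ ((d : ℝ) / ((d : ℝ) - 1)) with hy
  have hy1 : y ≤ 1 :=
    Real.rpow_le_one (by positivity) (by rw [div_le_one (by linarith)]; exact hD1) hp
  have hy0 : Real.exp (-(d * t)) ≤ y := by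
    have e1 : Real.exp (-(d * t)) = (1 / x) ^ ((d : ℝ) / ((d : ℝ) - 1)) := by
      rw [one_div, hx, ← Real.exp_neg, ← Real.exp_mul]
      congr 1
      field_simp
    rw [e1, hy]
    refine Real.rpow_le_rpow (by positivity) ?_ hp
    exact one_div_le_one_div_of_le (by linarith) hDx
  have hy00 : 0 ≤ y := (Real.exp_pos _).le.trans hy0
  have := pow_le_of_le_one (show 0 ≤ 1 - y by linarith) (by linarith) (show n ≠ 0 by omega)
  linarith

lemma limsup_ofReal_mul_lt_top {μ : Measure ℝ} [IsFiniteMeasure μ] {f : ℝ → ℝ} {C : ℝ}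
    (hf : ∀ t, 0 ≤ f t) (h : ∀ᶠ t in atTop, f t * μ.real (Ioi t) ≤ C) :
    limsup (fun t : ℝ => ENNReal.ofReal (f t) * μ (Ioi t)) atTop < ⊤ := by
  refine lt_of_le_of_lt (limsup_le_of_le (by isBoundedDefault) ?_) (ENNReal.ofReal_lt_top (r := C))
  filter_upwards [h] with t ht
  rw [← ofReal_measureReal (μ := μ) (s := Ioi t), ← ENNReal.ofReal_mul (hf t)]
  exact ENNReal.ofReal_le_ofReal ht

lemma orderStat_law_real_Ioi {n m : ℕ} (hn : 1 ≤ n) (ν : Measure ℝ) [IsProbabilityMeasure ν]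
    (t : ℝ) :
    ((Measure.pi fun _ : Fin (n + m) => ν).map (orderStat n)).real (Ioi t)
      = (Measure.pi fun _ : Fin (n + m) => ν).real
          {x | (Finset.univ.filter fun j => x j ≤ t).card < n} := by
  rw [map_measureReal_apply (measurable_orderStat hn (by omega)) measurableSet_Ioi]
  congr 1
  ext x
  exact lt_orderStat_iff hn (by omega) x t

lemma pi_real_card_lt_eq_binTail {n m : ℕ} (ν : Measure ℝ) [IsProbabilityMeasure ν] (t : ℝ) :
    (Measure.pi fun _ : Fin (n + m) => ν).real
        {x | (Finset.univ.filter fun j => x j ≤ t).card < n}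
      = binTail (n + m) n (ν.real (Ioi t)) := by
  have h := pi_real_card_filter_lt ν (Finset.univ : Finset (Fin (n + m))) MeasurableSet.univ t n
  simpa using h

end MDSQueue

/-! ### Limit laws and comparison of tails -/

theorem theorem1 (n m : ℕ) (hn : 1 ≤ n) (hm : 1 ≤ m) (lam : ℝ) (hlam : 0 < lam)
    (π : (k : ℕ) → Measure (Fin k → ℝ))
    (hstat : ∀ k, n + m ≤ k → MDSQueue.IsStationary n m lam (π k))
    (hind : MDSQueue.AsymptoticallyIndependent (n + m) π)
    (ν : Measure ℝ) [IsProbabilityMeasure ν] (hν : MDSQueue.IsLimitVirtualLaw π ν) :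
    -- the differential equation for `P (V > t)`, one-sided at `t = 0`
    (∀ t : ℝ, 0 ≤ t →
      HasDerivWithinAt (fun s : ℝ => ν.real (Ioi s))
        (-(ν.real (Ioi t))
          + (lam * ((m : ℝ) + n) / n) * ((n : ℝ) + m - 1) * ((n + m - 2).choose (n - 1) : ℝ)
            * ∑ i ∈ Finset.range n, ((n - 1).choose i : ℝ) * (-1) ^ i
              * (1 / (((m : ℝ) + i) * ((m : ℝ) + i + 1))) * (ν.real (Ioi t)) ^ (m + i + 1))
        (Ici 0) t) ∧
    limsup (fun t : ℝ => ENNReal.ofReal (Real.exp t) * ν (Ioi t)) atTop < ⊤ ∧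
    -- `γ` is the law of the batch completion time in the limit of many queues
    ∃ γ : Measure ℝ, IsProbabilityMeasure γ ∧
      (∀ t : ℝ, Tendsto (fun k => (MDSQueue.completionLaw n m (π k)).real (Ioi t)) atTop
        (𝓝 (γ.real (Ioi t)))) ∧
      γ = (Measure.pi fun _ : Fin (n + m) => ν).map (MDSQueue.orderStat n) ∧
      (∀ t : ℝ, γ.real (Ioi t)
        = ((n : ℝ) + m) * ((n + m - 1).choose (n - 1) : ℝ)
          * ∑ i ∈ Finset.range n, ((n - 1).choose i : ℝ) * (-1) ^ i
            * (1 / ((m : ℝ) + i + 1)) * (ν.real (Ioi t)) ^ (m + i + 1)) ∧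
      limsup (fun t : ℝ => ENNReal.ofReal (Real.exp (((m : ℝ) + 1) * t)) * γ (Ioi t)) atTop < ⊤ ∧
      ∀ d : ℕ, 2 ≤ d → d ≤ m →
        (fun t : ℝ => γ.real (Ioi t)) =o[atTop] MDSQueue.replicationTail lam n d := by
  have hπ : ∀ k, n + m ≤ k → IsProbabilityMeasure (π k) := fun k hk =>
    (hstat k hk).isProbabilityMeasure
  have hIoo : ∀ a b, ν (Ioo a b) ≤ ENNReal.ofReal (b - a) := fun a b =>
    MDSQueue.measure_open_le_of_isLimit (N := n + m) (by omega) hπ hν isOpen_Ioo fun k hk i => by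
      have := hπ k hk
      exact MDSQueue.virtualLaw_Ioo_le (π k) i a b
  have := MDSQueue.nullSingletonClass_of_Ioo_le hIoo
  have hH0 : ∀ t, 0 ≤ ν.real (Ioi t) := fun _ => measureReal_nonneg
  have hH1 : ∀ t, ν.real (Ioi t) ≤ 1 := fun _ => measureReal_le_one
  have hlim := MDSQueue.tendsto_real_Ioi_atTop ν
  have hode : ∀ t : ℝ, 0 ≤ t → HasDerivWithinAt (fun s : ℝ => ν.real (Ioi s))
      (-ν.real (Ioi t) + lam * ((m : ℝ) + n) / n * MDSQueue.intTail n m (ν.real (Ioi t)))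
      (Ici 0) t := fun t ht =>
    MDSQueue.hasDerivWithinAt_tail hn hm hlam hstat hind hIoo hν ht
  -- Only the comparison with replication uses this, to keep its denominator between 1 and
  -- e^(t(d-1)).
  have hlam1 : lam < 1 := MDSQueue.lam_lt_one hn hm hlam hH0 hH1 hlim
    (MDSQueue.real_Ioi_zero hn hstat hν) hode
  obtain ⟨K, hK0, hK⟩ := MDSQueue.exists_intTail_le hn hm
  have hα0 : 0 ≤ lam * ((m : ℝ) + n) / n := by positivity
  obtain ⟨C, hC0, hC⟩ := MDSQueue.exists_exp_mul_le_of_ode hα0 hK0 hK hH0 hH1 hlim hode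
  have hγ : ∀ t, ((Measure.pi fun _ : Fin (n + m) => ν).map (MDSQueue.orderStat n)).real (Ioi t)
      = MDSQueue.binTail (n + m) n (ν.real (Ioi t)) := fun t => by
    rw [MDSQueue.orderStat_law_real_Ioi hn, MDSQueue.pi_real_card_lt_eq_binTail]
  have hγprob : IsProbabilityMeasure
      ((Measure.pi fun _ : Fin (n + m) => ν).map (MDSQueue.orderStat n)) :=
    Measure.isProbabilityMeasure_map
      (MDSQueue.measurable_orderStat hn (by omega)).aemeasurable
  obtain ⟨K', hK'0, hK'⟩ := MDSQueue.exists_altSum_le n m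
  set c : ℝ := ((n : ℝ) + m) * ((n + m - 1).choose (n - 1) : ℝ) * K' * C ^ (m + 1) with hc
  have hγC : ∀ᶠ t in atTop, Real.exp (((m : ℝ) + 1) * t)
      * ((Measure.pi fun _ : Fin (n + m) => ν).map (MDSQueue.orderStat n)).real (Ioi t) ≤ c := by
    filter_upwards [hC] with t ht
    rw [hγ, MDSQueue.binTail_eq_altSum hn]
    have e1 : Real.exp (((m : ℝ) + 1) * t) = Real.exp t ^ (m + 1) := by
      rw [← Real.exp_nat_mul]; push_cast; rfl
    have e2 : (Real.exp t * ν.real (Ioi t)) ^ (m + 1) ≤ C ^ (m + 1) :=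
      pow_le_pow_left₀ (mul_nonneg (Real.exp_pos t).le (hH0 t)) ht _
    calc Real.exp (((m : ℝ) + 1) * t) * (((n : ℝ) + m) * ((n + m - 1).choose (n - 1) : ℝ)
          * MDSQueue.altSum n m (ν.real (Ioi t)))
        ≤ Real.exp (((m : ℝ) + 1) * t) * (((n : ℝ) + m) * ((n + m - 1).choose (n - 1) : ℝ)
          * (K' * ν.real (Ioi t) ^ (m + 1))) := by
          gcongr
          exact hK' _ (hH0 t) (hH1 t)
      _ = ((n : ℝ) + m) * ((n + m - 1).choose (n - 1) : ℝ) * K'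
          * (Real.exp t * ν.real (Ioi t)) ^ (m + 1) := by rw [e1, mul_pow]; ring
      _ ≤ c := by rw [hc]; gcongr
  refine ⟨fun t ht => ?_, MDSQueue.limsup_ofReal_mul_lt_top (fun t => (Real.exp_pos t).le) hC,
    (Measure.pi fun _ : Fin (n + m) => ν).map (MDSQueue.orderStat n), hγprob, fun t => ?_, rfl,
    fun t => ?_, MDSQueue.limsup_ofReal_mul_lt_top (fun t => (Real.exp_pos _).le) hγC,
    fun d hd hdm => ?_⟩
  · refine (hode t ht).congr_deriv ?_
    rw [MDSQueue.intTail]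
    ring
  · rw [MDSQueue.orderStat_law_real_Ioi hn]
    have h1 := MDSQueue.tendsto_integral_uniformOn
      (g := fun k σ => (MDSQueue.jointVirtualLaw (π k) σ).real
        {x | (Finset.univ.filter fun j => x j ≤ t).card < n})
      (MDSQueue.tendsto_jointVirtualLaw_real hπ hind hν
        (MDSQueue.pi_frontier_card_filter_lt ν Finset.univ t n))
    refine h1.congr' ?_
    filter_upwards [eventually_ge_atTop (n + m)] with k hk
    have := hπ k hk
    exact (MDSQueue.completionLaw_real_Ioi hn hk (π k) t).symm
  · rw [hγ, MDSQueue.binTail_eq_altSum hn]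
    rfl
  · have h1 : (fun t : ℝ => ((Measure.pi fun _ : Fin (n + m) => ν).map
        (MDSQueue.orderStat n)).real (Ioi t)) =O[atTop] fun t => Real.exp (-(((m : ℝ) + 1) * t)) := by
      refine IsBigO.of_bound c ?_
      filter_upwards [hγC] with t ht
      rw [Real.norm_of_nonneg measureReal_nonneg, Real.norm_of_nonneg (Real.exp_pos _).le,
        Real.exp_neg, ← div_eq_mul_inv, le_div_iff₀ (Real.exp_pos _), mul_comm]
      exact ht
    have h2 : (fun t : ℝ => Real.exp (-(((m : ℝ) + 1) * t))) =o[atTop]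
        fun t => Real.exp (-((d : ℝ) * t)) := by
      rw [Real.isLittleO_exp_comp_exp_comp]
      -- The gap between the exponents m + 1 and d is what makes the comparison strict.
      have hpos : (0 : ℝ) < (m : ℝ) + 1 - d := by
        have : (d : ℝ) ≤ m := by exact_mod_cast hdm
        linarith
      refine (tendsto_id.const_mul_atTop hpos).congr fun t => ?_
      simp only [id]
      ring
    have h3 : (fun t : ℝ => Real.exp (-((d : ℝ) * t))) =O[atTop]
        MDSQueue.replicationTail lam n d := by
      refine IsBigO.of_bound 1 ?_
      filter_upwards [eventually_ge_atTop 0] with t ht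
      have h4 := MDSQueue.exp_le_replicationTail hlam hlam1 hn hd ht
      rw [one_mul, Real.norm_of_nonneg (Real.exp_pos _).le]
      exact h4.trans (le_abs_self _)
    exact (h1.trans_isLittleO h2).trans_isBigO h3
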